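/- **Setting.** Let $M\ge 1$ and $N\ge 2$. Let $\mathcal G$ be a fixed, undirected, connected graph on $\{1,\dots,N\}$ without self-edges, with symmetric weighted adjacency matrix $A=[a_{ij}]$ ($a_{ij}>0$ if $\{i,j\}$ is an edge, $a_{ij}=0$ otherwise), and let $\mathcal N_i$ be the set of neighbours of $i$. Let $L$ be its Laplacian ($l_{ij}=-a_{ij}$ for $i\ne j$, $l_{ii}=\sum_j a_{ij}$), and let $\lambda_{\min}(\Lambda)$ be the smallest positive eigenvalue of $L$. The state $x_T=(x_T^{(0)},\dots,x_T^{(M-1)})\in\mathbb R^{3M}$ of a target with position $p_T=x_T^{(0)}\in\mathbb R^3$ obeys, on $[t_0,\infty)$, $$\dot x_T^{(m)}=x_T^{(m+1)}\ (0\le m<M-1),\qquad \dot x_T^{(M-1)}=u .$$ The target is autonomous if $u=0$; a piecewise continuous input $u:[t_0,\infty)\to\mathbb R^3$ is also considered, in which case $x_T$ is continuous and the last equation holds wherever $u$ is continuous. Agent $i$ has position $p_i(t)\in\mathbb R^3$ with $p_i(t)\neq p_T(t)$ for $t\ge t_0$ and measures the bearing $b_i=(p_T-p_i)/\|p_T-p_i\|$.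 Put $\Pi_{b_i}=I_3-b_ib_i^\top$, assumed continuous in $t\ge t_0$, and $y_i=\Pi_{b_i}p_i$, which equals $\Pi_{b_i}p_T$. With positive gains $k_1,\dots,k_M$ and $\alpha>0$, the observer of agent $i$ is $$\dot{\hat x}_i^{(m)}=\hat x_i^{(m+1)}+k_{m+1}\delta_i\ (m<M-1),\qquad \dot{\hat x}_i^{(M-1)}=k_M\delta_i,$$ $$\delta_i=\Pi_{b_i}\big(p_i-\hat x_i^{(0)}\big)-\alpha\sum_{j\in\mathcal N_i}a_{ij}\big(\hat x_i^{(0)}-\hat x_j^{(0)}\big),$$ and the estimation error $\tilde x\in\mathbb R^{3NM}$ has components $\tilde x_i^{(m)}=x_T^{(m)}-\hat x_i^{(m)}$. **Conditions.** Let $\delta,\gamma>0$, and let $\mu=\delta$ if $M=1$ and $\mu=(\delta k_1+k_2)/k_1^2$ if $M\ge2$. Assume: 1. $\frac1N\sum_{i=1}^N\Pi_{b_i(t)}\succ(\mu+\gamma)I_3$ for all $t\ge t_0$; 2. $\displaystyle \alpha>\frac{\mu+\frac1\gamma-1}{\lambda_{\min}(\Lambda)}$; 3. if $M\ge 3$,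 then $\bar\Sigma+\bar\Sigma^\top\succ0$, where, with $c_l=k_{l+1}/k_l$, the matrix $\bar\Sigma\in\mathbb R^{M\times M}$ has the entries $\bar\Sigma_{1j}=c_{M-1}$ for all $j$; $\bar\Sigma_{ij}=c_{M-i}-c_{M-i+1}$ for $2\le i\le j$ and $i<M$; $\bar\Sigma_{ij}=-c_{M-j}$ for $i=j+1$; $\bar\Sigma_{MM}=\delta$; and $\bar\Sigma_{ij}=0$ for $i>j+1$. **Claim.** (a) If $u=0$, the origin of the estimation error system is uniformly globally exponentially stable (UGES): there are constants $C,r>0$, depending only on the graph, its weights, $M$, the gains, $\delta$ and $\gamma$ (not on $t_0$, the agents' positions, or the target trajectory), such that for every initial time $s\ge t_0$ and every initial error the error system has a solution on $[s,\infty)$, and every solution satisfies $\|\tilde x(t)\|\le C e^{-r(t-s)}\|\tilde x(s)\|$ for all $t\ge s$. (b) The estimation error is input-to-state stable (ISS) with respect to $u$: there are a class $\mathcal{KL}$ function $\beta$ and a class $\mathcal K$ function $\rho$, depending only on the same data, such that for every bounded, piecewise continuous input $u$, every initial time $s\ge t_0$ and every initial error there is a solution on $[s,\infty)$, and every solution satisfies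 $$\|\tilde x(t)\|\le\beta(\|\tilde x(s)\|,t-s)+\rho\Big(\sup_{s\le\tau\le t}\|u(\tau)\|\Big)\quad\text{for all }t\ge s.$$ -/

import Mathlib

open scoped Topology

namespace BearingObserver

/-! ### Comparison functions and input signals -/

/-- Class `𝒦` functions on `[0, ∞)`. -/
structure IsClassK (ρ : ℝ → ℝ) : Prop where
  continuousOn : ContinuousOn ρ (Set.Ici 0)
  strictMonoOn : StrictMonoOn ρ (Set.Ici 0)
  map_zero : ρ 0 = 0

/-- Class `𝒦ℒ` functions on `[0, ∞) × [0, ∞)`. -/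
structure IsClassKL (β : ℝ → ℝ → ℝ) : Prop where
  continuousOn : ContinuousOn (fun q : ℝ × ℝ => β q.1 q.2) (Set.Ici 0 ×ˢ Set.Ici 0)
  classK : ∀ s, 0 ≤ s → IsClassK (fun r => β r s)
  antitoneOn : ∀ r, 0 ≤ r → AntitoneOn (β r) (Set.Ici 0)
  tendsto_zero : ∀ r, 0 ≤ r → Filter.Tendsto (β r) Filter.atTop (𝓝 0)

/-- Piecewise continuity on `[t₀, ∞)`: the discontinuities are finitely many in every bounded
interval, and all one-sided limits exist. -/
def PiecewiseContinuousFrom {E : Type*} [TopologicalSpace E] (t₀ : ℝ) (u : ℝ → E) : Prop :=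
  (∀ T : ℝ, {t ∈ Set.Icc t₀ T | ¬ ContinuousWithinAt u (Set.Ici t₀) t}.Finite) ∧
  (∀ t, t₀ ≤ t → ∃ l, Filter.Tendsto u (𝓝[>] t) (𝓝 l)) ∧
  (∀ t, t₀ < t → ∃ l, Filter.Tendsto u (𝓝[<] t) (𝓝 l))

/-- Boundedness on `[t₀, ∞)`. -/
def BoundedFrom {E : Type*} [Norm E] (t₀ : ℝ) (u : ℝ → E) : Prop :=
  ∃ B : ℝ, ∀ t, t₀ ≤ t → ‖u t‖ ≤ B

/-! ### Stability

A system on `[t₀, ∞)` is represented by its solutions: `Sol s ξ` says that `ξ` is a solution on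
`[s, ∞)` with initial time `s`. -/

/-- Every initial condition `ξ₀` at every initial time `s ≥ t₀` has a solution on `[s, ∞)`. -/
def ForwardComplete {E : Type*} (t₀ : ℝ) (Sol : ℝ → (ℝ → E) → Prop) : Prop :=
  ∀ s, t₀ ≤ s → ∀ ξ₀ : E, ∃ ξ : ℝ → E, Sol s ξ ∧ ξ s = ξ₀

/-- Uniform global exponential stability of the origin, with overshoot `C` and rate `r`. -/
def UGESWith {E : Type*} [Norm E] (C r t₀ : ℝ) (Sol : ℝ → (ℝ → E) → Prop) : Prop :=
  ForwardComplete t₀ Sol ∧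
  ∀ s, t₀ ≤ s → ∀ ξ, Sol s ξ → ∀ t, s ≤ t → ‖ξ t‖ ≤ C * Real.exp (-r * (t - s)) * ‖ξ s‖

/-- The input-to-state estimate with comparison functions `β`, `ρ` under the input `u`. -/
def ISSWith {E F : Type*} [Norm E] [Norm F] (β : ℝ → ℝ → ℝ) (ρ : ℝ → ℝ) (t₀ : ℝ) (u : ℝ → F)
    (Sol : ℝ → (ℝ → E) → Prop) : Prop :=
  ForwardComplete t₀ Sol ∧
  ∀ s, t₀ ≤ s → ∀ ξ, Sol s ξ → ∀ t, s ≤ t →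
    ‖ξ t‖ ≤ β ‖ξ s‖ (t - s) + ρ (sSup ((fun τ => ‖u τ‖) '' Set.Icc s t))

/-! ### Communication graph -/

/-- `A` is a weighted adjacency matrix of the undirected graph `G`. -/
structure IsWeightedAdjacency {N : ℕ} (G : SimpleGraph (Fin N)) (A : Matrix (Fin N) (Fin N) ℝ) :
    Prop where
  symm : A.IsSymm
  pos : ∀ i j, G.Adj i j → 0 < A i j
  zero : ∀ i j, ¬ G.Adj i j → A i j = 0

/-- The Laplacian: `lᵢⱼ = -aᵢⱼ` for `i ≠ j` and `lᵢᵢ = ∑ⱼ aᵢⱼ` (`aᵢⱼ = 0` off the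
neighbours of `i`, in particular `aᵢᵢ = 0`). -/
def laplacian {N : ℕ} (A : Matrix (Fin N) (Fin N) ℝ) : Matrix (Fin N) (Fin N) ℝ :=
  Matrix.of fun i j => if i = j then ∑ l, A i l else - A i j

/-- The smallest positive eigenvalue of a matrix (for the Laplacian of a connected graph on at
least two vertices the set is finite and nonempty). -/
noncomputable def minPosEigenvalue {N : ℕ} (L : Matrix (Fin N) (Fin N) ℝ) : ℝ :=
  sInf {l : ℝ | 0 < l ∧ Module.End.HasEigenvalue (Matrix.toLin' L) l}

/-! ### Bearings -/

/-- Physical space `ℝ³` with the Euclidean norm. -/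
abbrev Space := EuclideanSpace ℝ (Fin 3)

/-- The unit bearing from an agent at `p` to a target at `q` (used for `q ≠ p`). -/
noncomputable def bearing (p q : Space) : Space := ‖q - p‖⁻¹ • (q - p)

/-- `Π_b = I₃ - b bᵀ`. -/
def proj (b : Space) : Matrix (Fin 3) (Fin 3) ℝ := 1 - Matrix.vecMulVec b b

/-- Matrix-vector product on `ℝ³`. -/
noncomputable def act (Q : Matrix (Fin 3) (Fin 3) ℝ) (v : Space) : Space :=
  WithLp.toLp 2 (Q.mulVec v.ofLp)

/-- On `[t₀, ∞)` all bearings from the agents `p i` to the target at `q` are defined, and the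
measurement matrices depend continuously on time (they are automatically bounded). -/
structure IsBearingSensing {N : ℕ} (t₀ : ℝ) (p : Fin N → ℝ → Space) (q : ℝ → Space) : Prop where
  ne : ∀ t, t₀ ≤ t → ∀ i, q t ≠ p i t
  continuousOn : ∀ i, ContinuousOn (fun t => proj (bearing (p i t) (q t))) (Set.Ici t₀)

/-- Spatial excitation: `(1/N) ∑ᵢ Π_{bᵢ(t)} ≻ c I₃` for all `t ≥ t₀`. -/
def SpatialExcitation {N : ℕ} (c t₀ : ℝ) (p : Fin N → ℝ → Space) (q : ℝ → Space) : Prop :=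
  ∀ t, t₀ ≤ t →
    ((1 / (N : ℝ)) • ∑ i, proj (bearing (p i t) (q t)) -
      c • (1 : Matrix (Fin 3) (Fin 3) ℝ)).PosDef

/-! ### Target and observer. Gains are indexed as `k 1, …, k M`. -/

/-- `x` is a state trajectory on `[t₀, ∞)` of the chain of `M` integrators with input `u` at the
last derivative. For a piecewise continuous `u` the last equation is required where `u` is
continuous; for `u = 0` it is required everywhere. -/
structure IsTargetTrajectory {M : ℕ} (t₀ : ℝ) (u : ℝ → Space) (x : ℝ → Fin M → Space) :
    Prop where
  continuousOn : ContinuousOn x (Set.Ici t₀)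
  deriv_chain : ∀ t, t₀ ≤ t → ∀ m m' : Fin M, (m' : ℕ) = (m : ℕ) + 1 →
    HasDerivWithinAt (fun τ => x τ m) (x t m') (Set.Ici t₀) t
  deriv_last : ∀ t, t₀ ≤ t → ContinuousWithinAt u (Set.Ici t₀) t →
    ∀ m : Fin M, (m : ℕ) + 1 = M → HasDerivWithinAt (fun τ => x τ m) (u t) (Set.Ici t₀) t

/-- The correction term `δᵢ` of agent `i`, from the agents' positions `p`, the target position
`q` (which enters only through the bearing of agent `i`) and the position estimates `phat`. -/
noncomputable def correction {N : ℕ} (A : Matrix (Fin N) (Fin N) ℝ) (α : ℝ) (p : Fin N → Space)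
    (q : Space) (phat : Fin N → Space) (i : Fin N) : Space :=
  act (proj (bearing (p i) q)) (p i - phat i) - α • ∑ j, A i j • (phat i - phat j)

/-- `z` is a solution on `[s, ∞)` of the distributed observer; `z t i m` is the estimate by
agent `i` of the `m`-th component of the target state. -/
def IsObserverSolution {M N : ℕ} [NeZero M] (A : Matrix (Fin N) (Fin N) ℝ) (α : ℝ) (k : ℕ → ℝ)
    (p : Fin N → ℝ → Space) (q : ℝ → Space) (s : ℝ) (z : ℝ → Fin N → Fin M → Space) : Prop :=
  ∀ t, s ≤ t → ∀ (i : Fin N) (m : Fin M),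
    HasDerivWithinAt (fun τ => z τ i m)
      ((if h : (m : ℕ) + 1 < M then z t i ⟨(m : ℕ) + 1, h⟩ else 0) +
        k ((m : ℕ) + 1) • correction A α (fun j => p j t) (q t) (fun j => z t j 0) i)
      (Set.Ici s) t

/-- The space `ℝ^{3NM}` of estimation errors, with the Euclidean norm. -/
abbrev ErrorSpace (M N : ℕ) := PiLp 2 (fun _ : Fin M × Fin N => Space)

/-- The estimation error, with components `x^{(m)} - xhat_i^{(m)}`. -/
noncomputable def estimationError {M N : ℕ} (x : Fin M → Space) (z : Fin N → Fin M → Space) :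
    ErrorSpace M N :=
  WithLp.toLp 2 fun mi => x mi.1 - z mi.2 mi.1

/-- The solutions of the estimation error system along the target trajectory `x`. -/
def ErrorSolution {M N : ℕ} [NeZero M] (A : Matrix (Fin N) (Fin N) ℝ) (α : ℝ) (k : ℕ → ℝ)
    (p : Fin N → ℝ → Space) (x : ℝ → Fin M → Space) (s : ℝ) (e : ℝ → ErrorSpace M N) : Prop :=
  ∃ z : ℝ → Fin N → Fin M → Space,
    IsObserverSolution A α k p (fun t => x t 0) s z ∧
    ∀ t, s ≤ t → e t = estimationError (x t) (z t)

/-! ### Gain conditions -/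

/-- `μ = δ` if `M = 1`, and `μ = (δ k₁ + k₂) / k₁²` if `M ≥ 2`. -/
noncomputable def muConst (M : ℕ) (k : ℕ → ℝ) (δ : ℝ) : ℝ :=
  if M = 1 then δ else (δ * k 1 + k 2) / k 1 ^ 2

/-- The gain ratios `c_l = k_{l+1} / k_l`. -/
noncomputable def gainRatio (k : ℕ → ℝ) (l : ℕ) : ℝ := k (l + 1) / k l

/-- The entry in row `i` and column `j` of the gain matrix, with `1 ≤ i, j ≤ M`. -/
noncomputable def sigmaEntry (M : ℕ) (k : ℕ → ℝ) (δ : ℝ) (i j : ℕ) : ℝ :=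
  if i = 1 then gainRatio k (M - 1)
  else if i ≤ j ∧ i < M then gainRatio k (M - i) - gainRatio k (M - i + 1)
  else if i = j + 1 then - gainRatio k (M - j)
  else if i = M ∧ j = M then δ
  else 0

/-- The gain matrix `Σ`. -/
noncomputable def sigmaBar (M : ℕ) (k : ℕ → ℝ) (δ : ℝ) : Matrix (Fin M) (Fin M) ℝ :=
  Matrix.of fun i j => sigmaEntry M k δ ((i : ℕ) + 1) ((j : ℕ) + 1)

/-- `Q = Σ + Σᵀ`. -/
noncomputable def qBar (M : ℕ) (k : ℕ → ℝ) (δ : ℝ) : Matrix (Fin M) (Fin M) ℝ :=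
  sigmaBar M k δ + (sigmaBar M k δ).transpose

end BearingObserver

/-!
Divide the errors in the successive derivatives of the target position by the gains,
`Yₘ = x̃⁽ᵐ⁻¹⁾ / kₘ`, and pass to the increments `ηₘ = Yₘ - Yₘ₋₁` with `Y₀ = 0`. The correction then
enters only the first increment and the input only the last one, and in reversed order the
contribution of the integrator chain to half the derivative of `∑ ‖ηₘ‖²` is
`-ηᵀ Σ̄ η + (δ + c₁) ‖Y₁‖²` with `δ + c₁ = k₁ μ`. Since `Σ̄ + Σ̄ᵀ ≻ 0` (for `M = 2` it is diagonal,
and `M = 1` is direct), the chain is dissipative up to the term `k₁ μ ‖Y₁‖²`.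

That term is absorbed by the correction, which is linear in the position errors `vᵢ`. Write these
as a common mean plus deviations of sum zero: excitation bounds the measurement form from below on
the mean, the spectral gap of the Laplacian bounds the consensus form on the deviations, and the
mixed terms are split by Young's inequality with weight `γ`, which leaves `μ ∑ᵢ ‖vᵢ‖²`. Hence the
sum `V` of the `‖ηₘ‖²` over all agents satisfies `V' ≤ r (b² - V)` with `b` proportional to the size
of the input, and Grönwall's inequality gives an exponential estimate with linear input gain.
-/

namespace BearingObserver

section GlobalSolutions

variable {E : Type*} [NormedAddCommGroup E] [NormedSpace ℝ E] {f : ℝ → E → E}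

theorem isIntegralCurveOn_Icc_ite {y z : ℝ → E} {a c d : ℝ} (hac : a ≤ c) (hcd : c ≤ d)
    (hyz : y c = z c) (hy : IsIntegralCurveOn y f (Set.Icc a c))
    (hz : IsIntegralCurveOn z f (Set.Icc c d)) :
    IsIntegralCurveOn (fun t => if t ≤ c then y t else z t) f (Set.Icc a d) := by
  set g : ℝ → E := fun t => if t ≤ c then y t else z t
  have extend {w : ℝ → E} {p q : ℝ} (hw : IsIntegralCurveOn w f (Set.Icc p q))
      (hgw : Set.EqOn g w (Set.Icc p q)) (t : ℝ) :
      HasDerivWithinAt g (f t (g t)) (Set.Icc p q) t := by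
    by_cases ht : t ∈ Set.Icc p q
    · rw [hgw ht]
      exact (hw t ht).congr hgw (hgw ht)
    · exact HasFDerivWithinAt.of_notMem_closure (by rwa [isClosed_Icc.closure_eq])
  have gy : Set.EqOn g y (Set.Icc a c) := fun t ht => if_pos ht.2
  have gz : Set.EqOn g z (Set.Icc c d) := by
    intro t ht
    rcases ht.1.eq_or_lt with rfl | hlt
    · exact (if_pos le_rfl).trans hyz
    · exact if_neg hlt.not_ge
  intro t _
  rw [← Set.Icc_union_Icc_eq_Icc hac hcd]
  exact (extend hy gy t).union (extend hz gz t)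

theorem isIntegralCurveOn_Icc_eqOn {K : NNReal} {y z : ℝ → E} {a b : ℝ}
    (hlip : ∀ t ∈ Set.Icc a b, LipschitzWith K (f t)) (hyz : y a = z a)
    (hy : IsIntegralCurveOn y f (Set.Icc a b)) (hz : IsIntegralCurveOn z f (Set.Icc a b)) :
    Set.EqOn y z (Set.Icc a b) := by
  have right_deriv {w : ℝ → E} (hw : IsIntegralCurveOn w f (Set.Icc a b)) :
      ∀ t ∈ Set.Ico a b, HasDerivWithinAt w (f t (w t)) (Set.Ici t) t := fun t ht =>
    ((hw t (Set.Ico_subset_Icc_self ht)).mono (Set.Icc_subset_Icc_left ht.1)).mono_of_mem_nhdsWithin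
      (Icc_mem_nhdsGE ht.2)
  exact ODE_solution_unique_of_mem_Icc_right (s := fun _ => Set.univ)
    (fun t ht => (hlip t (Set.Ico_subset_Icc_self ht)).lipschitzOnWith)
    hy.continuousOn (right_deriv hy) (fun _ _ => trivial)
    hz.continuousOn (right_deriv hz) (fun _ _ => trivial) hyz

theorem exists_isIntegralCurveOn_Ici_of_forall_Icc {s : ℝ} {x₀ : E}
    (hlip : ∀ T, ∃ K, ∀ t ∈ Set.Icc s T, LipschitzWith K (f t))
    (hex : ∀ T, ∃ y : ℝ → E, y s = x₀ ∧ IsIntegralCurveOn y f (Set.Icc s T)) :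
    ∃ y : ℝ → E, y s = x₀ ∧ IsIntegralCurveOn y f (Set.Ici s) := by
  choose Y hYs hY using hex
  have agree {T T' t : ℝ} (hst : s ≤ t) (hT : t ≤ T) (hT' : t ≤ T') : Y T t = Y T' t := by
    obtain ⟨K, hK⟩ := hlip t
    exact isIntegralCurveOn_Icc_eqOn hK ((hYs T).trans (hYs T').symm)
      ((hY T).mono (Set.Icc_subset_Icc_right hT)) ((hY T').mono (Set.Icc_subset_Icc_right hT'))
      ⟨hst, le_rfl⟩
  refine ⟨fun t => Y (t + 1) t, hYs _, fun t (ht : s ≤ t) => ?_⟩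
  have near : Set.Iio (t + 1) ∈ 𝓝[Set.Ici s] t := nhdsWithin_le_nhds (Iio_mem_nhds (by linarith))
  have hderiv := (hY (t + 1) t ⟨ht, by linarith⟩).mono_of_mem_nhdsWithin
    (s := Set.Ici s) (by filter_upwards [self_mem_nhdsWithin, near] with τ h₁ h₂ using ⟨h₁, h₂.le⟩)
  refine hderiv.congr_of_eventuallyEq ?_ rfl
  filter_upwards [self_mem_nhdsWithin, near] with τ hτ hlt
  exact agree hτ (by linarith) hlt.le

variable [CompleteSpace E]

theorem exists_isIntegralCurveOn_Icc_of_mul_le_half {K : NNReal} {a b : ℝ} (hab : a ≤ b)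
    (hKab : K * (b - a) ≤ 1 / 2) (hlip : ∀ t ∈ Set.Icc a b, LipschitzWith K (f t))
    (hcont : ∀ x, ContinuousOn (fun t => f t x) (Set.Icc a b)) (x₀ : E) :
    ∃ y : ℝ → E, y a = x₀ ∧ IsIntegralCurveOn y f (Set.Icc a b) := by
  have ha : a ∈ Set.Icc a b := ⟨le_rfl, hab⟩
  obtain ⟨B, hB⟩ := isCompact_Icc.exists_bound_of_continuousOn (hcont x₀)
  lift B to NNReal using (norm_nonneg _).trans (hB a ha)
  have hba : 0 ≤ b - a := sub_nonneg.2 hab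
  -- On the ball of radius `2 * B * (b - a)` about `x₀` the field is bounded by `2 * B`.
  have picard : IsPicardLindelof f ⟨a, ha⟩ x₀ (2 * B * (b - a).toNNReal) 0 (2 * B) K := by
    refine ⟨fun t ht => (hlip t ht).lipschitzOnWith, fun x _ => hcont x, fun t ht x hx => ?_, ?_⟩
    · have hx' : dist x x₀ ≤ 2 * B * (b - a) := by
        simpa only [Metric.mem_closedBall, NNReal.coe_mul, NNReal.coe_ofNat,
          Real.coe_toNNReal _ hba] using hx
      calc ‖f t x‖ ≤ ‖f t x₀‖ + dist (f t x) (f t x₀) := by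
            rw [dist_eq_norm]; exact norm_le_norm_add_norm_sub' _ _
        _ ≤ B + K * (2 * B * (b - a)) := by
            gcongr
            · exact hB t ht
            · exact ((hlip t ht).dist_le_mul x x₀).trans (by gcongr)
        _ = B + 2 * B * (K * (b - a)) := by ring
        _ ≤ B + 2 * B * (1 / 2) := by gcongr
        _ = (2 * B : NNReal) := by push_cast; ring
    · simp [hba]
  exact picard.exists_eq_forall_mem_Icc_hasDerivWithinAt₀

theorem exists_isIntegralCurveOn_Icc_of_mul_le_two_pow {K : NNReal} (n : ℕ) {a b : ℝ}
    (hab : a ≤ b) (hKab : K * (b - a) ≤ 2 ^ n / 2)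
    (hlip : ∀ t ∈ Set.Icc a b, LipschitzWith K (f t))
    (hcont : ∀ x, ContinuousOn (fun t => f t x) (Set.Icc a b)) (x₀ : E) :
    ∃ y : ℝ → E, y a = x₀ ∧ IsIntegralCurveOn y f (Set.Icc a b) := by
  induction n generalizing a b x₀ with
  | zero =>
    exact exists_isIntegralCurveOn_Icc_of_mul_le_half hab (by simpa using hKab) hlip hcont x₀
  | succ n ih =>
    have left_le : a ≤ (a + b) / 2 := by linarith
    have le_right : (a + b) / 2 ≤ b := by linarith
    have half_le : K * ((b - a) / 2) ≤ (2 : ℝ) ^ n / 2 := by rw [pow_succ] at hKab; linarith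
    have left : Set.Icc a ((a + b) / 2) ⊆ Set.Icc a b := Set.Icc_subset_Icc_right le_right
    have right : Set.Icc ((a + b) / 2) b ⊆ Set.Icc a b := Set.Icc_subset_Icc_left left_le
    obtain ⟨y, hya, hy⟩ := ih left_le (by convert half_le using 2; ring)
      (fun t ht => hlip t (left ht)) (fun x => (hcont x).mono left) x₀
    obtain ⟨z, hzc, hz⟩ := ih le_right (by convert half_le using 2; ring)
      (fun t ht => hlip t (right ht)) (fun x => (hcont x).mono right) (y ((a + b) / 2))
    exact ⟨_, by simp [left_le, hya], isIntegralCurveOn_Icc_ite left_le le_right hzc.symm hy hz⟩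

theorem exists_isIntegralCurveOn_Ici {s : ℝ}
    (hlip : ∀ T, ∃ K, ∀ t ∈ Set.Icc s T, LipschitzWith K (f t))
    (hcont : ∀ x, ContinuousOn (fun t => f t x) (Set.Ici s)) (x₀ : E) :
    ∃ y : ℝ → E, y s = x₀ ∧ IsIntegralCurveOn y f (Set.Ici s) := by
  refine exists_isIntegralCurveOn_Ici_of_forall_Icc hlip fun T => ?_
  obtain ⟨K, hK⟩ := hlip (max s T)
  obtain ⟨n, hn⟩ := pow_unbounded_of_one_lt (2 * (K * (max s T - s))) one_lt_two
  obtain ⟨y, hys, hy⟩ := exists_isIntegralCurveOn_Icc_of_mul_le_two_pow n (le_max_left s T)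
    (by linarith) hK (fun x => (hcont x).mono Set.Icc_subset_Ici_self) x₀
  exact ⟨y, hys, hy.mono (Set.Icc_subset_Icc_right (le_max_right s T))⟩

theorem exists_isIntegralCurveOn_Ici_of_linear {A : ℝ → E →L[ℝ] E} {b : ℝ → E} {s : ℝ}
    (hA : ContinuousOn A (Set.Ici s)) (hb : ContinuousOn b (Set.Ici s)) (x₀ : E) :
    ∃ y : ℝ → E, y s = x₀ ∧ IsIntegralCurveOn y (fun t x => A t x + b t) (Set.Ici s) := by
  refine exists_isIntegralCurveOn_Ici (f := fun t x => A t x + b t) (fun T => ?_)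
    (fun x => (hA.clm_apply continuousOn_const).add hb) x₀
  obtain ⟨B, hB⟩ := isCompact_Icc.exists_bound_of_continuousOn
    (hA.mono (Set.Icc_subset_Ici_self : Set.Icc s T ⊆ _))
  refine ⟨B.toNNReal, fun t ht => LipschitzWith.of_dist_le_mul fun x y => ?_⟩
  rw [dist_add_right, dist_eq_norm, dist_eq_norm, ← map_sub]
  exact ((A t).le_opNorm _).trans
    (by gcongr; exact (hB t ht).trans (Real.le_coe_toNNReal B))

end GlobalSolutions

section HermitianForms

variable {ι V : Type*} [Fintype ι] [NormedAddCommGroup V] [InnerProductSpace ℝ V]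
  {L : Matrix ι ι ℝ}

theorem sum_inner_sum_smul_of_diagonal {φ : ι → ι → ℝ} {c : ι → ℝ} (v : ι → V)
    (hφ : ∀ i j, L i j = ∑ m, c m * (φ m i * φ m j)) :
    ∑ i, inner ℝ (v i) (∑ j, L i j • v j) = ∑ m, c m * ‖∑ i, φ m i • v i‖ ^ 2 := by
  simp only [hφ, ← real_inner_self_eq_norm_sq, sum_inner, inner_sum, inner_smul_left,
    inner_smul_right, Finset.mul_sum, Finset.sum_mul, Real.ringHom_apply]
  rw [Finset.sum_comm_cycle]
  refine Finset.sum_congr rfl fun m _ => ?_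
  rw [Finset.sum_comm]
  exact Finset.sum_congr rfl fun i _ => Finset.sum_congr rfl fun j _ => by ring

section Eigenbasis

variable [DecidableEq ι]

/-- The coefficient of a family of vectors of `V` at the `m`-th vector of the orthonormal eigenbasis
of a Hermitian matrix, the eigenvectors acting on such families by their real components. -/
noncomputable def eigencoefficient (hL : L.IsHermitian) (v : ι → V) (m : ι) : V :=
  ∑ i, hL.eigenvectorBasis m i • v i

theorem sum_norm_sq_eq_sum_eigencoefficient (hL : L.IsHermitian) (v : ι → V) :
    ∑ i, ‖v i‖ ^ 2 = ∑ m, ‖eigencoefficient hL v m‖ ^ 2 := by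
  have resolution_of_one (i j : ι) : (1 : Matrix ι ι ℝ) i j =
      ∑ m, 1 * (hL.eigenvectorBasis m i * hL.eigenvectorBasis m j) := by
    rw [← Unitary.coe_mul_star_self hL.eigenvectorUnitary]
    simp [Matrix.mul_apply]
  have := sum_inner_sum_smul_of_diagonal v resolution_of_one
  simpa [Matrix.one_apply, eigencoefficient] using this

theorem sum_inner_sum_smul_eq_sum_eigencoefficient (hL : L.IsHermitian) (v : ι → V) :
    ∑ i, inner ℝ (v i) (∑ j, L i j • v j) =
      ∑ m, hL.eigenvalues m * ‖eigencoefficient hL v m‖ ^ 2 := by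
  refine sum_inner_sum_smul_of_diagonal v fun i j => ?_
  conv_lhs => rw [hL.spectral_theorem, Unitary.conjStarAlgAut_apply]
  rw [Matrix.mul_apply]
  simp only [Matrix.mul_diagonal, Matrix.star_apply, Matrix.IsHermitian.eigenvectorUnitary_apply,
    Function.comp_apply, star_trivial, RCLike.ofReal_real_eq_id, id_eq]
  exact Finset.sum_congr rfl fun m _ => by ring

theorem mul_sum_norm_sq_le_of_eigencoefficient (hL : L.IsHermitian) {l : ℝ} {v : ι → V}
    (hl : ∀ m, eigencoefficient hL v m ≠ 0 → l ≤ hL.eigenvalues m) :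
    l * ∑ i, ‖v i‖ ^ 2 ≤ ∑ i, inner ℝ (v i) (∑ j, L i j • v j) := by
  rw [sum_norm_sq_eq_sum_eigencoefficient hL, sum_inner_sum_smul_eq_sum_eigencoefficient hL,
    Finset.mul_sum]
  refine Finset.sum_le_sum fun m _ => ?_
  rcases eq_or_ne (eigencoefficient hL v m) 0 with hm | hm
  · simp [hm]
  · gcongr
    exact hl m hm

end Eigenbasis

theorem exists_pos_mul_sum_norm_sq_le_of_posDef (hL : L.PosDef) :
    ∃ q > 0, ∀ v : ι → V, q * ∑ i, ‖v i‖ ^ 2 ≤ ∑ i, inner ℝ (v i) (∑ j, L i j • v j) := by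
  classical
  obtain ⟨q, hq, hle⟩ : ∃ q > 0, ∀ m, q ≤ hL.isHermitian.eigenvalues m := by
    rcases isEmpty_or_nonempty ι with hι | hι
    · exact ⟨1, one_pos, isEmptyElim⟩
    · obtain ⟨m, hm⟩ := Finite.exists_min hL.isHermitian.eigenvalues
      exact ⟨_, hL.eigenvalues_pos m, hm⟩
  exact ⟨q, hq, fun v => mul_sum_norm_sq_le_of_eigencoefficient _ fun m _ => hle m⟩

end HermitianForms

section Laplacian

variable {V : Type*} [NormedAddCommGroup V] [InnerProductSpace ℝ V]

theorem sum_inner_sum_smul_sub {ι : Type*} [Fintype ι] {A : Matrix ι ι ℝ} (hA : A.IsSymm)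
    (v : ι → V) :
    ∑ i, inner ℝ (v i) (∑ j, A i j • (v i - v j)) = (∑ i, ∑ j, A i j * ‖v i - v j‖ ^ 2) / 2 := by
  have expand : ∑ i, inner ℝ (v i) (∑ j, A i j • (v i - v j)) =
      ∑ i, ∑ j, A i j * inner ℝ (v i) (v i - v j) := by
    simp only [inner_sum, inner_smul_right]
  have swap : ∑ i, inner ℝ (v i) (∑ j, A i j • (v i - v j)) =
      ∑ i, ∑ j, A i j * inner ℝ (v j) (v j - v i) := by
    rw [expand, Finset.sum_comm]
    simp only [hA.apply]
  rw [eq_div_iff two_ne_zero, mul_two]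
  nth_rewrite 1 [expand]
  rw [swap]
  simp only [← Finset.sum_add_distrib, ← mul_add]
  refine Finset.sum_congr rfl fun i _ => Finset.sum_congr rfl fun j _ => ?_
  rw [← real_inner_self_eq_norm_sq, inner_sub_left, ← neg_sub (v i) (v j), inner_neg_right,
    ← sub_eq_add_neg]

variable {N : ℕ} {G : SimpleGraph (Fin N)} {A : Matrix (Fin N) (Fin N) ℝ}

theorem IsWeightedAdjacency.nonneg (hA : IsWeightedAdjacency G A) (i j : Fin N) : 0 ≤ A i j := by
  by_cases h : G.Adj i j
  · exact (hA.pos i j h).le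
  · exact (hA.zero i j h).ge

theorem IsWeightedAdjacency.isHermitian_laplacian (hA : IsWeightedAdjacency G A) :
    (laplacian A).IsHermitian := by
  refine Matrix.IsHermitian.ext fun i j => ?_
  rcases eq_or_ne i j with rfl | hij
  · rfl
  · simp [laplacian, hij, hij.symm, hA.symm.apply]

theorem IsWeightedAdjacency.sum_laplacian_smul (hA : IsWeightedAdjacency G A) (v : Fin N → V)
    (i : Fin N) : ∑ j, laplacian A i j • v j = ∑ j, A i j • (v i - v j) := by
  have entry (j : Fin N) :
      laplacian A i j • v j = (if i = j then (∑ l, A i l) • v i else 0) - A i j • v j := by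
    rcases eq_or_ne i j with rfl | hij
    · simp [laplacian, hA.zero i i G.irrefl]
    · simp [laplacian, hij]
  simp only [entry, smul_sub, Finset.sum_sub_distrib, Finset.sum_ite_eq, Finset.mem_univ, if_true,
    Finset.sum_smul]

theorem IsWeightedAdjacency.sum_inner_nonneg (hA : IsWeightedAdjacency G A) (v : Fin N → V) :
    0 ≤ ∑ i, inner ℝ (v i) (∑ j, A i j • (v i - v j)) := by
  rw [sum_inner_sum_smul_sub hA.symm]
  exact div_nonneg (Finset.sum_nonneg fun i _ => Finset.sum_nonneg fun j _ =>
    mul_nonneg (hA.nonneg i j) (sq_nonneg _)) zero_le_two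

theorem IsWeightedAdjacency.eq_of_sum_inner_eq_zero (hA : IsWeightedAdjacency G A)
    (hG : G.Connected) {v : Fin N → V}
    (hv : ∑ i, inner ℝ (v i) (∑ j, A i j • (v i - v j)) = 0) (i j : Fin N) : v i = v j := by
  have term_nonneg (i j : Fin N) : 0 ≤ A i j * ‖v i - v j‖ ^ 2 :=
    mul_nonneg (hA.nonneg i j) (sq_nonneg _)
  have term_eq_zero (i j : Fin N) : A i j * ‖v i - v j‖ ^ 2 = 0 := by
    rw [sum_inner_sum_smul_sub hA.symm, div_eq_zero_iff, or_iff_left two_ne_zero,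
      Finset.sum_eq_zero_iff_of_nonneg
        fun i _ => Finset.sum_nonneg fun j _ => term_nonneg i j] at hv
    exact (Finset.sum_eq_zero_iff_of_nonneg fun j _ => term_nonneg i j).1
      (hv i (Finset.mem_univ i)) j (Finset.mem_univ j)
  obtain ⟨walk⟩ := hG.preconnected i j
  induction walk with
  | nil => rfl
  | cons hadj _ ih =>
    have := (mul_eq_zero.1 (term_eq_zero _ _)).resolve_left (hA.pos _ _ hadj).ne'
    rw [← ih]
    exact sub_eq_zero.1 (norm_eq_zero.1 (pow_eq_zero_iff two_ne_zero |>.1 this))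

theorem IsWeightedAdjacency.eigenvalue_mem_of_sum_eq_zero (hA : IsWeightedAdjacency G A)
    (hG : G.Connected) {v : Fin N → V} (hv : ∑ i, v i = 0) {m : Fin N}
    (hm : eigencoefficient hA.isHermitian_laplacian v m ≠ 0) :
    hA.isHermitian_laplacian.eigenvalues m ∈
      {l : ℝ | 0 < l ∧ Module.End.HasEigenvalue (Matrix.toLin' (laplacian A)) l} := by
  have hL := hA.isHermitian_laplacian
  set φ : Fin N → ℝ := (hL.eigenvectorBasis m).ofLp
  have eigen : (laplacian A).mulVec φ = hL.eigenvalues m • φ := hL.mulVec_eigenvectorBasis m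
  have φ_ne_zero : φ ≠ 0 := fun h => hm (by simp [eigencoefficient, φ, congrFun h])
  have form_eq : ∑ i, inner ℝ (φ i) (∑ j, A i j • (φ i - φ j)) =
      hL.eigenvalues m * ∑ i, φ i ^ 2 := by
    rw [Finset.mul_sum]
    refine Finset.sum_congr rfl fun i _ => ?_
    rw [← hA.sum_laplacian_smul]
    have : ∑ j, laplacian A i j • φ j = hL.eigenvalues m • φ i := congrFun eigen i
    rw [this, real_inner_eq_re_inner]
    simp [sq, mul_assoc]
  have sum_sq_pos : 0 < ∑ i, φ i ^ 2 := by
    obtain ⟨i, hi⟩ := Function.ne_iff.1 φ_ne_zero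
    exact Finset.sum_pos' (fun i _ => sq_nonneg _) ⟨i, Finset.mem_univ i, sq_pos_of_ne_zero hi⟩
  have eigenvalue_nonneg : 0 ≤ hL.eigenvalues m :=
    nonneg_of_mul_nonneg_left (form_eq ▸ hA.sum_inner_nonneg φ) sum_sq_pos
  have eigenvalue_ne_zero : hL.eigenvalues m ≠ 0 := fun h0 => hm <| by
    have const (i : Fin N) : φ i = φ m :=
      hA.eq_of_sum_inner_eq_zero hG (by rw [form_eq, h0, zero_mul]) i m
    calc ∑ i, φ i • v i = φ m • ∑ i, v i := by simp only [const, Finset.smul_sum]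
      _ = 0 := by rw [hv, smul_zero]
  refine ⟨eigenvalue_nonneg.lt_of_ne' eigenvalue_ne_zero,
    Module.End.hasEigenvalue_of_hasEigenvector (x := φ)
      ⟨Module.End.mem_eigenspace_iff.2 ?_, φ_ne_zero⟩⟩
  rw [Matrix.toLin'_apply, eigen]

theorem IsWeightedAdjacency.minPosEigenvalue_pos (hA : IsWeightedAdjacency G A)
    (hG : G.Connected) (hN : 2 ≤ N) : 0 < minPosEigenvalue (laplacian A) := by
  have hL := hA.isHermitian_laplacian
  have : Nontrivial (Fin N) := Fin.nontrivial_iff_two_le.2 hN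
  obtain ⟨a, b, hab⟩ := exists_pair_ne (Fin N)
  let v : Fin N → ℝ := Pi.single a 1 - Pi.single b 1
  have sum_v : ∑ i, v i = 0 := by simp [v]
  have v_a : v a = 1 := by simp [v, hab]
  obtain ⟨m, hm⟩ : ∃ m, eigencoefficient hL v m ≠ 0 := by
    by_contra! h
    have sum_sq : ∑ i, ‖v i‖ ^ 2 = 0 := by
      simp only [sum_norm_sq_eq_sum_eigencoefficient hL, h, norm_zero, ne_eq, two_ne_zero,
        not_false_eq_true, zero_pow, Finset.sum_const_zero]
    have := (Finset.sum_eq_zero_iff_of_nonneg fun i _ => by positivity).1 sum_sq a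
    simp [v_a] at this
  have finite : {l : ℝ | 0 < l ∧ Module.End.HasEigenvalue (Matrix.toLin' (laplacian A)) l}.Finite :=
    (Module.End.finite_hasEigenvalue (Matrix.toLin' (laplacian A))).subset fun l hl => hl.2
  exact (Set.Nonempty.csInf_mem ⟨_, hA.eigenvalue_mem_of_sum_eq_zero hG sum_v hm⟩ finite).1

theorem IsWeightedAdjacency.minPosEigenvalue_mul_sum_norm_sq_le (hA : IsWeightedAdjacency G A)
    (hG : G.Connected) {v : Fin N → V} (hv : ∑ i, v i = 0) :
    minPosEigenvalue (laplacian A) * ∑ i, ‖v i‖ ^ 2 ≤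
      ∑ i, inner ℝ (v i) (∑ j, A i j • (v i - v j)) := by
  simp only [← hA.sum_laplacian_smul]
  exact mul_sum_norm_sq_le_of_eigencoefficient hA.isHermitian_laplacian fun m hm =>
    csInf_le ⟨0, fun l hl => hl.1.le⟩ (hA.eigenvalue_mem_of_sum_eq_zero hG hv hm)

end Laplacian

section Coercivity

variable {V : Type*} [NormedAddCommGroup V] [InnerProductSpace ℝ V]

theorem inner_add_map_add_ge_of_isPositive {P : V →ₗ[ℝ] V} (hP : P.IsPositive) {γ : ℝ}
    (hγ : 0 < γ) (a w : V) :
    (1 - γ) * inner ℝ a (P a) + (1 - 1 / γ) * inner ℝ w (P w) ≤ inner ℝ (a + w) (P (a + w)) := by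
  have square : 0 ≤ 1 / γ * inner ℝ (γ • a + w) (P (γ • a + w)) :=
    mul_nonneg (by positivity) (hP.inner_nonneg_right _)
  have symm : inner ℝ w (P a) = inner ℝ a (P w) := by
    rw [← hP.isSymmetric w a, real_inner_comm]
  have cancel : 1 / γ * γ = 1 := one_div_mul_cancel hγ.ne'
  simp only [map_add, map_smul, inner_add_left, inner_add_right, real_inner_smul_left,
    real_inner_smul_right, symm] at square ⊢
  linear_combination square + (γ * inner ℝ a (P a) + 2 * inner ℝ a (P w)) * cancel

theorem inner_add_map_add_ge_of_le_one {P : V →ₗ[ℝ] V} (hP : P.IsPositive)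
    (hP1 : ∀ x, inner ℝ x (P x) ≤ ‖x‖ ^ 2) {γ : ℝ} (hγ : 0 < γ) (hγ1 : γ ≤ 1) (a w : V) :
    inner ℝ a (P a) - γ * ‖a‖ ^ 2 + (1 - 1 / γ) * ‖w‖ ^ 2 ≤ inner ℝ (a + w) (P (a + w)) := by
  have young := inner_add_map_add_ge_of_isPositive hP hγ a w
  have mean_part := mul_le_mul_of_nonneg_left (hP1 a) hγ.le
  have deviation_part := mul_le_mul_of_nonneg_left (hP1 w) (sub_nonneg.2 ((one_le_div hγ).2 hγ1))
  linarith

theorem exists_eq_add_of_sum_eq_zero {ι : Type*} [Fintype ι] [Nonempty ι] (v : ι → V) :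
    ∃ (a : V) (w : ι → V), ∑ i, w i = 0 ∧ ∀ i, v i = a + w i := by
  refine ⟨(Fintype.card ι : ℝ)⁻¹ • ∑ i, v i, fun i => v i - (Fintype.card ι : ℝ)⁻¹ • ∑ i, v i,
    ?_, fun i => (add_sub_cancel _ _).symm⟩
  rw [Finset.sum_sub_distrib, Finset.sum_const, Finset.card_univ, ← Nat.cast_smul_eq_nsmul ℝ,
    smul_inv_smul₀ (Nat.cast_ne_zero.2 Fintype.card_ne_zero), sub_self]

theorem sum_norm_add_sq_of_sum_eq_zero {ι : Type*} [Fintype ι] (a : V) {w : ι → V}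
    (hw : ∑ i, w i = 0) :
    ∑ i, ‖a + w i‖ ^ 2 = Fintype.card ι * ‖a‖ ^ 2 + ∑ i, ‖w i‖ ^ 2 := by
  simp only [norm_add_sq_real, Finset.sum_add_distrib, ← Finset.mul_sum, ← inner_sum, hw,
    inner_zero_right, Finset.sum_const, Finset.card_univ, nsmul_eq_mul, mul_zero, add_zero]

variable {N : ℕ} {G : SimpleGraph (Fin N)} {A : Matrix (Fin N) (Fin N) ℝ}

theorem mul_sum_norm_sq_le_sum_inner_correction (hG : G.Connected)
    (hA : IsWeightedAdjacency G A) {α γ μ : ℝ} (hα : 0 ≤ α) (hγ : 0 < γ) (hγ1 : γ ≤ 1)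
    (hαγ : μ + 1 / γ - 1 ≤ α * minPosEigenvalue (laplacian A)) {P : Fin N → V →ₗ[ℝ] V}
    (hP : ∀ i, (P i).IsPositive) (hP1 : ∀ i x, inner ℝ x (P i x) ≤ ‖x‖ ^ 2)
    (hexc : ∀ x, (μ + γ) * (N * ‖x‖ ^ 2) ≤ ∑ i, inner ℝ x (P i x)) (v : Fin N → V) :
    μ * ∑ i, ‖v i‖ ^ 2 ≤ ∑ i, inner ℝ (v i) (P i (v i) + α • ∑ j, A i j • (v i - v j)) := by
  have := hG.nonempty
  obtain ⟨a, w, hw, hv⟩ := exists_eq_add_of_sum_eq_zero v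
  have measurements : μ * (N * ‖a‖ ^ 2) + (1 - 1 / γ) * ∑ i, ‖w i‖ ^ 2 ≤
      ∑ i, inner ℝ (v i) (P i (v i)) := by
    calc μ * (N * ‖a‖ ^ 2) + (1 - 1 / γ) * ∑ i, ‖w i‖ ^ 2
      _ ≤ ∑ i, inner ℝ a (P i a) - N * (γ * ‖a‖ ^ 2) + (1 - 1 / γ) * ∑ i, ‖w i‖ ^ 2 := by
          linarith [hexc a]
      _ = ∑ i, (inner ℝ a (P i a) - γ * ‖a‖ ^ 2 + (1 - 1 / γ) * ‖w i‖ ^ 2) := by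
          simp only [Finset.sum_add_distrib, Finset.sum_sub_distrib, Finset.mul_sum,
            Finset.sum_const, Finset.card_univ, Fintype.card_fin, nsmul_eq_mul]
      _ ≤ ∑ i, inner ℝ (v i) (P i (v i)) := Finset.sum_le_sum fun i _ => by
          rw [hv]
          exact inner_add_map_add_ge_of_le_one (hP i) (hP1 i) hγ hγ1 a (w i)
  have consensus : (μ + 1 / γ - 1) * ∑ i, ‖w i‖ ^ 2 ≤
      α * ∑ i, inner ℝ (v i) (∑ j, A i j • (v i - v j)) := by
    calc (μ + 1 / γ - 1) * ∑ i, ‖w i‖ ^ 2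
      _ ≤ α * (minPosEigenvalue (laplacian A) * ∑ i, ‖w i‖ ^ 2) := by
          rw [← mul_assoc]; gcongr
      _ ≤ α * ∑ i, inner ℝ (w i) (∑ j, A i j • (w i - w j)) := by
          gcongr
          exact hA.minPosEigenvalue_mul_sum_norm_sq_le hG hw
      _ = α * ∑ i, inner ℝ (v i) (∑ j, A i j • (v i - v j)) := by
          rw [sum_inner_sum_smul_sub hA.symm, sum_inner_sum_smul_sub hA.symm]
          simp only [hv, add_sub_add_left_eq_sub]
  calc μ * ∑ i, ‖v i‖ ^ 2 = μ * (N * ‖a‖ ^ 2) + μ * ∑ i, ‖w i‖ ^ 2 := by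
        simp only [hv, sum_norm_add_sq_of_sum_eq_zero a hw, Fintype.card_fin, mul_add]
    _ ≤ ∑ i, inner ℝ (v i) (P i (v i)) +
        α * ∑ i, inner ℝ (v i) (∑ j, A i j • (v i - v j)) := by linarith
    _ = ∑ i, inner ℝ (v i) (P i (v i) + α • ∑ j, A i j • (v i - v j)) := by
        simp only [inner_add_right, real_inner_smul_right, Finset.sum_add_distrib, Finset.mul_sum]

end Coercivity

section Bearings

theorem norm_bearing {p q : Space} (h : q ≠ p) : ‖bearing p q‖ = 1 :=
  norm_smul_inv_norm (𝕜 := ℝ) (sub_ne_zero.2 h)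

theorem act_proj (b v : Space) : act (proj b) v = v - inner ℝ b v • b := by
  ext i
  simp only [act, proj, Matrix.sub_mulVec, Matrix.one_mulVec, Matrix.vecMulVec_mulVec]
  simp [EuclideanSpace.inner_eq_star_dotProduct, dotProduct_comm]

theorem act_proj_eq_starProjection {b : Space} (hb : ‖b‖ = 1) (v : Space) :
    act (proj b) v = (ℝ ∙ b)ᗮ.starProjection v := by
  rw [act_proj, Submodule.starProjection_orthogonal_val,
    Submodule.starProjection_unit_singleton ℝ hb]

theorem toEuclideanLin_proj {b : Space} (hb : ‖b‖ = 1) :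
    Matrix.toEuclideanLin (proj b) = ((ℝ ∙ b)ᗮ.starProjection : Space →ₗ[ℝ] Space) :=
  LinearMap.ext (act_proj_eq_starProjection hb)

theorem act_proj_bearing_eq {p q : Space} (h : q ≠ p) :
    act (proj (bearing p q)) p = act (proj (bearing p q)) q := by
  have hpq : q - p = ‖q - p‖ • bearing p q :=
    (smul_inv_smul₀ (norm_ne_zero_iff.2 (sub_ne_zero.2 h)) _).symm
  have blind : (ℝ ∙ bearing p q)ᗮ.starProjection (q - p) = 0 := by
    rw [hpq, map_smul, Submodule.starProjection_orthogonalComplement_singleton_eq_zero, smul_zero]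
  rw [act_proj_eq_starProjection (norm_bearing h), act_proj_eq_starProjection (norm_bearing h)]
  exact (sub_eq_zero.1 (by rw [← map_sub, blind])).symm

theorem isPositive_toEuclideanLin_proj {b : Space} (hb : ‖b‖ = 1) :
    (Matrix.toEuclideanLin (proj b)).IsPositive := by
  rw [toEuclideanLin_proj hb]
  exact (ContinuousLinearMap.IsPositive.of_isStarProjection
    isStarProjection_starProjection).toLinearMap

theorem inner_toEuclideanLin_proj_le {b : Space} (hb : ‖b‖ = 1) (x : Space) :
    inner ℝ x (Matrix.toEuclideanLin (proj b) x) ≤ ‖x‖ ^ 2 := by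
  rw [toEuclideanLin_proj hb, sq]
  exact (real_inner_le_norm _ _).trans (by gcongr; exact Submodule.norm_starProjection_apply_le _ x)

variable {N : ℕ} {t t₀ c : ℝ} {p : Fin N → ℝ → Space} {q : ℝ → Space}

theorem SpatialExcitation.mul_norm_sq_le [NeZero N] (h : SpatialExcitation c t₀ p q) (ht : t₀ ≤ t)
    (x : Space) :
    c * (N * ‖x‖ ^ 2) ≤
      ∑ i, inner ℝ x (Matrix.toEuclideanLin (proj (bearing (p i t) (q t))) x) := by
  have nonneg := (Matrix.isPositive_toEuclideanLin_iff.2 (h t ht).posSemidef).inner_nonneg_right x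
  rw [map_sub, map_smul, map_smul, map_sum, Matrix.toLpLin_one] at nonneg
  simp only [LinearMap.sub_apply, LinearMap.smul_apply, LinearMap.sum_apply, LinearMap.id_apply,
    inner_sub_right, real_inner_smul_right, inner_sum, real_inner_self_eq_norm_sq] at nonneg
  rw [one_div, sub_nonneg, le_inv_mul_iff₀ (Nat.cast_pos.2 (NeZero.pos N))] at nonneg
  linarith

theorem SpatialExcitation.le_one [NeZero N] (h : SpatialExcitation c t₀ p q)
    (hb : IsBearingSensing t₀ p q) (ht : t₀ ≤ t) : c ≤ 1 := by
  obtain ⟨x, hx⟩ := exists_norm_eq Space zero_le_one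
  have bound := (h.mul_norm_sq_le ht x).trans (Finset.sum_le_sum fun i _ =>
    inner_toEuclideanLin_proj_le (norm_bearing (hb.ne t ht i)) x)
  have hN : (0 : ℝ) < N := Nat.cast_pos.2 (NeZero.pos N)
  simp only [hx, one_pow, mul_one, Finset.sum_const, Finset.card_univ, Fintype.card_fin,
    nsmul_eq_mul] at bound
  exact (mul_le_iff_le_one_left hN).1 bound

end Bearings

section GainMatrix

variable {M : ℕ} {k : ℕ → ℝ} {δ : ℝ}

theorem gainRatio_pos (hk : ∀ m, 1 ≤ m → m ≤ M → 0 < k m) {l : ℕ} (hl : 1 ≤ l) (hlM : l < M) :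
    0 < gainRatio k l :=
  div_pos (hk _ (by omega) hlM) (hk _ hl hlM.le)

theorem muConst_pos [NeZero M] (hk : ∀ m, 1 ≤ m → m ≤ M → 0 < k m) (hδ : 0 < δ) :
    0 < muConst M k δ := by
  have hM : 1 ≤ M := NeZero.one_le
  rw [muConst]
  split_ifs with h
  · exact hδ
  · have h1 := hk 1 le_rfl hM
    have h2 := hk 2 one_le_two (by omega)
    positivity

theorem mul_muConst_of_two_le (hM : 2 ≤ M) (hk₁ : k 1 ≠ 0) :
    k 1 * muConst M k δ = δ + gainRatio k 1 := by
  rw [muConst, if_neg (by omega), gainRatio]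
  field_simp

theorem posDef_qBar_two (hk : ∀ m, 1 ≤ m → m ≤ 2 → 0 < k m) (hδ : 0 < δ) :
    (qBar 2 k δ).PosDef := by
  have hdiag : qBar 2 k δ = Matrix.diagonal ![2 * gainRatio k 1, 2 * δ] := by
    ext i j
    fin_cases i <;> fin_cases j <;> simp [qBar, sigmaBar, sigmaEntry, two_mul]
  have hc : 0 < gainRatio k 1 := gainRatio_pos hk le_rfl one_lt_two
  rw [hdiag, Matrix.posDef_diagonal_iff, Fin.forall_fin_two]
  exact ⟨by simpa using hc, by simpa using hδ⟩

theorem sigmaEntry_sub_sub (hM : 2 ≤ M) {m n : ℕ} (hm : m < M) (hn : n < M) :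
    sigmaEntry M k δ (M - m) (M - n) =
      (if n < m + 1 then if m = 0 then δ + gainRatio k 1 else gainRatio k m else 0) -
        if n < m + 2 then if m + 1 < M then gainRatio k (m + 1) else 0 else 0 := by
  have hsub : ∀ {l}, l < M → M - (M - l) = l := by omega
  simp only [sigmaEntry, hsub hm, hsub hn]
  rcases eq_or_ne (m + 1) M with rfl | hlast
  · simp [hn, show m ≠ 0 by omega]
  rw [if_neg (by omega), if_pos (by omega : m + 1 < M)]
  rcases lt_trichotomy n (m + 1) with h | rfl | h
  · rcases eq_or_ne m 0 with rfl | hm0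
    · obtain rfl : n = 0 := by omega
      simp
    · rw [if_pos (by omega), if_pos h, if_neg hm0, if_pos (by omega)]
  · rw [if_neg (by omega), if_pos (by omega), if_neg (by omega), if_pos (by omega), zero_sub]
  · rw [if_neg (by omega), if_neg (by omega), if_neg (by omega), if_neg (by omega),
      if_neg (by omega), sub_zero]

variable {V : Type*} [NormedAddCommGroup V] [InnerProductSpace ℝ V]

theorem sum_ite_lt_smul_sub {Y : ℕ → V} (hY : Y 0 = 0) (c : ℝ) {p : ℕ} (hp : p ≤ M) :
    ∑ n ∈ Finset.range M, (if n < p then c else 0) • (Y (n + 1) - Y n) = c • Y p := by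
  simp only [ite_smul, zero_smul]
  rw [← Finset.sum_filter, show (Finset.range M).filter (· < p) = Finset.range p by grind,
    ← Finset.smul_sum, Finset.sum_range_sub, hY, sub_zero]

/-- If `Y m` is the error in the `(m - 1)`-th derivative of the target position divided by the
gain `k m`, with `Y 0 = 0`, then this is the contribution of the integrator chain to the
derivative of `Y m`. -/
noncomputable def chainDrift (k : ℕ → ℝ) (Y : ℕ → V) (m : ℕ) : V :=
  if m = 0 then 0 else gainRatio k m • Y (m + 1)

theorem sum_sigmaBar_rev_smul_sub (hM : 2 ≤ M) {Y : ℕ → V} (hY₀ : Y 0 = 0)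
    (hYM : Y (M + 1) = 0) (m : Fin M) :
    ∑ n : Fin M, sigmaBar M k δ m.rev n.rev • (Y (n + 1) - Y n) =
      (if (m : ℕ) = 0 then (δ + gainRatio k 1) • Y 1 else 0) -
        (chainDrift k Y (m + 1) - chainDrift k Y m) := by
  have hrev (l : Fin M) : (l.rev : ℕ) + 1 = M - l := by rw [Fin.val_rev]; omega
  simp only [sigmaBar, Matrix.of_apply, hrev]
  rw [Fin.sum_univ_eq_sum_range (fun n => sigmaEntry M k δ (M - m) (M - n) • (Y (n + 1) - Y n)),
    Finset.sum_congr rfl fun n hn => by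
      rw [sigmaEntry_sub_sub hM m.isLt (Finset.mem_range.1 hn), sub_smul],
    Finset.sum_sub_distrib, sum_ite_lt_smul_sub hY₀ _ (by omega)]
  have hnext : ∑ n ∈ Finset.range M,
      (if n < (m : ℕ) + 2 then if (m : ℕ) + 1 < M then gainRatio k (m + 1) else 0 else 0) •
        (Y (n + 1) - Y n) = chainDrift k Y (m + 1) := by
    rw [chainDrift, if_neg (Nat.succ_ne_zero _)]
    by_cases hm : (m : ℕ) + 1 < M
    · simp only [hm, if_true]
      exact sum_ite_lt_smul_sub hY₀ _ (by omega)
    · simp [show (m : ℕ) + 1 = M by omega, hYM]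
  rw [hnext, chainDrift.eq_1 k Y m]
  by_cases hm : (m : ℕ) = 0
  · simp [hm]
  · simp only [hm, if_false]
    abel

theorem sum_inner_sum_add_transpose_smul {ι : Type*} [Fintype ι] (S : Matrix ι ι ℝ) (v : ι → V) :
    ∑ i, inner ℝ (v i) (∑ j, (S + S.transpose) i j • v j) =
      2 * ∑ i, inner ℝ (v i) (∑ j, S i j • v j) := by
  simp only [Matrix.add_apply, Matrix.transpose_apply, add_smul, Finset.sum_add_distrib,
    inner_add_right, inner_sum, real_inner_smul_right, two_mul]
  rw [add_right_inj, Finset.sum_comm]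
  simp only [real_inner_comm]

theorem sum_inner_sub_chainDrift_eq (hM : 2 ≤ M) {Y : ℕ → V} (hY₀ : Y 0 = 0)
    (hYM : Y (M + 1) = 0) :
    ∑ m : Fin M, inner ℝ (Y (m + 1) - Y m) (chainDrift k Y (m + 1) - chainDrift k Y m) =
      (δ + gainRatio k 1) * ‖Y 1‖ ^ 2 -
        ∑ m : Fin M, inner ℝ (Y (m + 1) - Y m)
          (∑ n : Fin M, sigmaBar M k δ m.rev n.rev • (Y (n + 1) - Y n)) := by
  have hfirst : ∑ m : Fin M, inner ℝ (Y (m + 1) - Y m)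
      (if (m : ℕ) = 0 then (δ + gainRatio k 1) • Y 1 else 0) =
        (δ + gainRatio k 1) * ‖Y 1‖ ^ 2 := by
    rw [Finset.sum_eq_single (⟨0, by omega⟩ : Fin M)
      (fun m _ hm => by simp [show (m : ℕ) ≠ 0 from fun h => hm (Fin.ext h)]) (by simp)]
    simp [hY₀, real_inner_smul_right]
  simp only [sum_sigmaBar_rev_smul_sub hM hY₀ hYM, inner_sub_right _ (ite _ _ _),
    Finset.sum_sub_distrib, hfirst, sub_sub_cancel]

theorem exists_sum_inner_sub_chainDrift_le [NeZero M] (hk : ∀ m, 1 ≤ m → m ≤ M → 0 < k m)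
    (hδ : 0 < δ) (hQ : 3 ≤ M → (qBar M k δ).PosDef) :
    ∃ q > 0, ∀ Y : ℕ → V, Y 0 = 0 → Y (M + 1) = 0 →
      ∑ m : Fin M, inner ℝ (Y (m + 1) - Y m) (chainDrift k Y (m + 1) - chainDrift k Y m) ≤
        k 1 * muConst M k δ * ‖Y 1‖ ^ 2 - q * ∑ m : Fin M, ‖Y (m + 1) - Y m‖ ^ 2 := by
  have hM : 1 ≤ M := NeZero.one_le
  have hk₁ : 0 < k 1 := hk 1 le_rfl hM
  rcases Nat.eq_or_lt_of_le hM with rfl | hM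
  · exact ⟨k 1 * δ, by positivity, fun Y hY₀ hY₂ => by simp [chainDrift, hY₀, hY₂, muConst]⟩
  have hQ : (qBar M k δ).PosDef := by
    rcases Nat.eq_or_lt_of_le hM with rfl | hM
    · exact posDef_qBar_two hk hδ
    · exact hQ hM
  set S := (sigmaBar M k δ).submatrix Fin.rev Fin.rev with hS
  have hQrev : (S + S.transpose).PosDef := hQ.submatrix Fin.rev_injective
  obtain ⟨q, hq, hle⟩ := exists_pos_mul_sum_norm_sq_le_of_posDef (V := V) hQrev
  refine ⟨q / 2, half_pos hq, fun Y hY₀ hYM => ?_⟩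
  have hform := hle fun m => Y (m + 1) - Y m
  rw [sum_inner_sum_add_transpose_smul] at hform
  simp only [hS, Matrix.submatrix_apply] at hform
  rw [sum_inner_sub_chainDrift_eq (δ := δ) hM hY₀ hYM, mul_muConst_of_two_le hM hk₁.ne']
  linarith

end GainMatrix

section LyapunovCoordinates

variable {M : ℕ} {k : ℕ → ℝ} {V : Type*} [NormedAddCommGroup V] [InnerProductSpace ℝ V]

/-- The error in the `(n - 1)`-th derivative of the target position divided by the gain `k n`,
for `1 ≤ n ≤ M`; it is zero for all other `n`. -/
noncomputable def scaledError (k : ℕ → ℝ) : ℕ → (Fin M → V) →L[ℝ] V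
  | 0 => 0
  | n + 1 => if h : n < M then (k (n + 1))⁻¹ • ContinuousLinearMap.proj ⟨n, h⟩ else 0

theorem scaledError_zero_apply (v : Fin M → V) : scaledError k 0 v = 0 := rfl

theorem scaledError_succ_apply (m : Fin M) (v : Fin M → V) :
    scaledError k (m + 1) v = (k (m + 1))⁻¹ • v m := by
  simp [scaledError]

theorem scaledError_apply_of_lt {n : ℕ} (hn : M < n) (v : Fin M → V) : scaledError k n v = 0 := by
  obtain ⟨n, rfl⟩ := Nat.exists_eq_succ_of_ne_zero hn.ne_bot
  simp [scaledError, show ¬ n < M by omega]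

/-- The successive differences of the scaled errors. In these coordinates the correction enters
only the first component. -/
noncomputable def scaledIncrement (k : ℕ → ℝ) (m : Fin M) : (Fin M → V) →L[ℝ] V :=
  scaledError k (m + 1) - scaledError k m

theorem eq_zero_of_scaledIncrement_eq_zero (hk : ∀ m, 1 ≤ m → m ≤ M → 0 < k m)
    {v : Fin M → V} (hv : ∀ m, scaledIncrement k m v = 0) : v = 0 := by
  have hscaled (n : ℕ) (hn : n ≤ M) : scaledError k n v = 0 := by
    induction n with
    | zero => rfl
    | succ n ih => exact (sub_eq_zero.1 (hv ⟨n, hn⟩)).trans (ih (by omega))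
  funext m
  have := hscaled (m + 1) m.isLt
  rw [scaledError_succ_apply] at this
  exact (smul_eq_zero_iff_right (inv_ne_zero (hk _ (by omega) m.isLt).ne')).1 this

/-- The right-hand side of a chain of `M` integrators with input `w` at the last component and
correction `d` injected with the gains `k`. -/
noncomputable def chainField (k : ℕ → ℝ) (w d : V) (v : Fin M → V) (m : Fin M) : V :=
  (if h : (m : ℕ) + 1 < M then v ⟨m + 1, h⟩ else w) - k (m + 1) • d

theorem scaledError_succ_chainField (hk : ∀ m, 1 ≤ m → m ≤ M → 0 < k m) (w d : V)
    (v : Fin M → V) (m : Fin M) :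
    scaledError k (m + 1) (chainField k w d v) =
      chainDrift k (fun n => scaledError k n v) (m + 1) +
        (if (m : ℕ) + 1 = M then (k M)⁻¹ • w else 0) - d := by
  have hkm : k (m + 1) ≠ 0 := (hk _ (by omega) m.isLt).ne'
  rw [scaledError_succ_apply, chainField, smul_sub, inv_smul_smul₀ hkm, chainDrift,
    if_neg (Nat.succ_ne_zero _)]
  congr 1
  by_cases hm : (m : ℕ) + 1 < M
  · have hkm' : k (m + 1 + 1) ≠ 0 := (hk _ (by omega) hm).ne'
    rw [dif_pos hm, if_neg hm.ne, add_zero, scaledError_succ_apply ⟨m + 1, hm⟩, smul_smul,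
      gainRatio, div_mul_eq_mul_div, mul_inv_cancel₀ hkm', one_div]
  · have hm' : (m : ℕ) + 1 = M := by omega
    rw [dif_neg hm, if_pos hm', scaledError_apply_of_lt (by omega), smul_zero, zero_add, hm']

theorem scaledIncrement_chainField (hk : ∀ m, 1 ≤ m → m ≤ M → 0 < k m) (w d : V)
    (v : Fin M → V) (m : Fin M) :
    scaledIncrement k m (chainField k w d v) =
      chainDrift k (fun n => scaledError k n v) (m + 1) -
          chainDrift k (fun n => scaledError k n v) m +
        (if (m : ℕ) + 1 = M then (k M)⁻¹ • w else 0) - if (m : ℕ) = 0 then d else 0 := by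
  rw [scaledIncrement, sub_apply, scaledError_succ_chainField hk]
  obtain ⟨_ | m, hm⟩ := m
  · simp [chainDrift, scaledError_zero_apply]
  · have := scaledError_succ_chainField hk w d v ⟨m, by omega⟩
    simp only at this ⊢
    rw [this, if_neg (by omega : m + 1 ≠ M), if_neg (Nat.succ_ne_zero m)]
    abel

theorem two_mul_inner_le_mul_norm_sq_add_div {q : ℝ} (hq : 0 < q) (x y : V) :
    2 * inner ℝ x y ≤ q * ‖x‖ ^ 2 + ‖y‖ ^ 2 / q := by
  have hsq : q * ‖x‖ ^ 2 + ‖y‖ ^ 2 / q - 2 * (‖x‖ * ‖y‖) = (q * ‖x‖ - ‖y‖) ^ 2 / q := by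
    field_simp
    ring
  have : 0 ≤ (q * ‖x‖ - ‖y‖) ^ 2 / q := by positivity
  linarith [real_inner_le_norm x y]

theorem sum_inner_scaledIncrement_chainField [NeZero M] (hk : ∀ m, 1 ≤ m → m ≤ M → 0 < k m)
    (w d : V) (v : Fin M → V) :
    ∑ m, inner ℝ (scaledIncrement k m v) (scaledIncrement k m (chainField k w d v)) =
      ∑ m : Fin M, inner ℝ (scaledIncrement k m v)
          (chainDrift k (fun n => scaledError k n v) (m + 1) -
            chainDrift k (fun n => scaledError k n v) m) +
        inner ℝ (scaledIncrement k (Fin.rev 0) v) ((k M)⁻¹ • w) -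
          inner ℝ (scaledError k 1 v) d := by
  have hM : 0 < M := NeZero.pos M
  have hinput : ∑ m : Fin M, inner ℝ (scaledIncrement k m v)
      (if (m : ℕ) + 1 = M then (k M)⁻¹ • w else 0) =
        inner ℝ (scaledIncrement k (Fin.rev 0) v) ((k M)⁻¹ • w) := by
    rw [Finset.sum_eq_single (Fin.rev 0) (fun m _ hm => ?_) (by simp)]
    · simp [Nat.sub_add_cancel hM]
    · have : (m : ℕ) + 1 ≠ M := fun h => hm (Fin.ext (by simp; omega))
      rw [if_neg this, inner_zero_right]
  have hcorrection : ∑ m : Fin M, inner ℝ (scaledIncrement k m v)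
      (if (m : ℕ) = 0 then d else 0) = inner ℝ (scaledError k 1 v) d := by
    rw [Finset.sum_eq_single 0 (fun m _ hm => ?_) (by simp)]
    · simp [scaledIncrement, scaledError_zero_apply]
    · rw [if_neg (Fin.val_ne_zero_iff.2 hm), inner_zero_right]
  simp only [scaledIncrement_chainField hk, inner_sub_right _ _ (ite _ _ _), inner_add_right,
    Finset.sum_sub_distrib, Finset.sum_add_distrib, hinput, hcorrection]

theorem sum_inner_scaledIncrement_chainField_le [NeZero M] (hk : ∀ m, 1 ≤ m → m ≤ M → 0 < k m)
    {q κ : ℝ} (hq : 0 < q)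
    (hdrift : ∀ Y : ℕ → V, Y 0 = 0 → Y (M + 1) = 0 →
      ∑ m : Fin M, inner ℝ (Y (m + 1) - Y m) (chainDrift k Y (m + 1) - chainDrift k Y m) ≤
        κ * ‖Y 1‖ ^ 2 - q * ∑ m : Fin M, ‖Y (m + 1) - Y m‖ ^ 2) (w d : V) (v : Fin M → V) :
    2 * ∑ m, inner ℝ (scaledIncrement k m v) (scaledIncrement k m (chainField k w d v)) ≤
      2 * (κ * ‖scaledError k 1 v‖ ^ 2 - inner ℝ (scaledError k 1 v) d) -
        q * ∑ m, ‖scaledIncrement k m v‖ ^ 2 + ‖(k M)⁻¹ • w‖ ^ 2 / q := by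
  have hyoung := two_mul_inner_le_mul_norm_sq_add_div hq
    (scaledIncrement k (Fin.rev 0) v) ((k M)⁻¹ • w)
  have hlast : q * ‖scaledIncrement k (Fin.rev 0) v‖ ^ 2 ≤ q * ∑ m, ‖scaledIncrement k m v‖ ^ 2 :=
    mul_le_mul_of_nonneg_left (Finset.single_le_sum
      (f := fun m => ‖scaledIncrement k m v‖ ^ 2) (fun _ _ => sq_nonneg _)
      (Finset.mem_univ _)) hq.le
  have hchain : ∑ m : Fin M, inner ℝ (scaledIncrement k m v)
      (chainDrift k (fun n => scaledError k n v) (m + 1) -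
        chainDrift k (fun n => scaledError k n v) m) ≤
      κ * ‖scaledError k 1 v‖ ^ 2 - q * ∑ m, ‖scaledIncrement k m v‖ ^ 2 :=
    hdrift (fun n => scaledError k n v) rfl (scaledError_apply_of_lt M.lt_succ_self v)
  rw [sum_inner_scaledIncrement_chainField hk]
  linarith

end LyapunovCoordinates

section ErrorCoordinates

variable {M N : ℕ} {k : ℕ → ℝ}

/-- The block of the estimation error that belongs to agent `i`. -/
noncomputable def agentError (i : Fin N) : ErrorSpace M N →L[ℝ] Fin M → Space :=
  ContinuousLinearMap.pi fun m => PiLp.proj 2 _ (m, i)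

/-- The change of coordinates from estimation errors to the increments of the scaled errors of
all agents; the squared norm of its value is the Lyapunov function of the error system. -/
noncomputable def lyapunovMap (k : ℕ → ℝ) : ErrorSpace M N →L[ℝ] ErrorSpace M N :=
  (PiLp.continuousLinearEquiv 2 ℝ _).symm.toContinuousLinearMap ∘L
    ContinuousLinearMap.pi fun mi => scaledIncrement k mi.1 ∘L agentError mi.2

theorem inner_lyapunovMap (e f : ErrorSpace M N) :
    inner ℝ (lyapunovMap k e) (lyapunovMap k f) =
      ∑ i, ∑ m, inner ℝ (scaledIncrement k m (agentError i e))
        (scaledIncrement k m (agentError i f)) := by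
  rw [PiLp.inner_apply, Fintype.sum_prod_type_right]
  rfl

theorem norm_sq_lyapunovMap (e : ErrorSpace M N) :
    ‖lyapunovMap k e‖ ^ 2 = ∑ i, ∑ m, ‖scaledIncrement k m (agentError i e)‖ ^ 2 := by
  simp only [← real_inner_self_eq_norm_sq, inner_lyapunovMap]

theorem lyapunovMap_injective (hk : ∀ m, 1 ≤ m → m ≤ M → 0 < k m) :
    Function.Injective (lyapunovMap (M := M) (N := N) k) := by
  refine (injective_iff_map_eq_zero _).2 fun e he => ?_
  have hagent (i : Fin N) : agentError i e = 0 :=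
    eq_zero_of_scaledIncrement_eq_zero hk fun m => congrArg (fun f => f.ofLp (m, i)) he
  ext1 mi
  exact congrFun (hagent mi.2) mi.1

theorem exists_pos_norm_le_mul_norm_lyapunovMap (hk : ∀ m, 1 ≤ m → m ≤ M → 0 < k m) :
    ∃ K > 0, ∀ e : ErrorSpace M N, ‖e‖ ≤ K * ‖lyapunovMap k e‖ := by
  obtain ⟨K, hK, hT⟩ := (lyapunovMap (M := M) (N := N) k).toLinearMap.exists_antilipschitzWith
    (LinearMap.ker_eq_bot.2 (lyapunovMap_injective hk))
  exact ⟨K, hK, fun e => by simpa using hT.le_mul_norm_sub e 0⟩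

end ErrorCoordinates

section ExponentialDecay

variable {E : Type*} [NormedAddCommGroup E] [InnerProductSpace ℝ E]

theorem norm_le_exp_mul_norm_add_of_inner_deriv_right_le {ξ ξ' : ℝ → E} {q b s T : ℝ} (hb : 0 ≤ b)
    (hsT : s ≤ T) (hξ : ContinuousOn ξ (Set.Icc s T))
    (hξ' : ∀ t ∈ Set.Ico s T, HasDerivWithinAt ξ (ξ' t) (Set.Ici t) t)
    (hle : ∀ t ∈ Set.Ico s T, 2 * inner ℝ (ξ t) (ξ' t) ≤ q * (b ^ 2 - ‖ξ t‖ ^ 2)) :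
    ‖ξ T‖ ≤ Real.exp (-(q / 2) * (T - s)) * ‖ξ s‖ + b := by
  have hgronwall : ‖ξ T‖ ^ 2 - b ^ 2 ≤ (‖ξ s‖ ^ 2 - b ^ 2) * Real.exp (-q * (T - s)) := by
    rw [← gronwallBound_ε0]
    refine le_gronwallBound_of_liminf_deriv_right_le (f := fun t => ‖ξ t‖ ^ 2 - b ^ 2)
      ((hξ.norm.pow 2).sub continuousOn_const)
      (fun t ht r hr => (((hξ' t ht).norm_sq).sub_const (b ^ 2)).liminf_right_slope_le hr) le_rfl
      (fun t ht => ?_) T ⟨hsT, le_rfl⟩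
    linarith [hle t ht]
  have hexp : Real.exp (-q * (T - s)) = Real.exp (-(q / 2) * (T - s)) ^ 2 := by
    rw [← Real.exp_nat_mul]
    ring_nf
  set η := Real.exp (-(q / 2) * (T - s))
  have hη : 0 < η := Real.exp_pos _
  refine (sq_le_sq₀ (norm_nonneg _) (by positivity)).1 ?_
  calc ‖ξ T‖ ^ 2 ≤ (η * ‖ξ s‖) ^ 2 + b ^ 2 := by
        rw [hexp] at hgronwall
        nlinarith [mul_nonneg (sq_nonneg b) (sq_nonneg η)]
    _ ≤ (η * ‖ξ s‖ + b) ^ 2 := by nlinarith [mul_nonneg (mul_nonneg hη.le (norm_nonneg (ξ s))) hb]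

end ExponentialDecay

section ErrorDynamics

open Filter

theorem PiecewiseContinuousFrom.eventually_continuousWithinAt {E : Type*} [TopologicalSpace E]
    {t₀ t : ℝ} {u : ℝ → E} (hu : PiecewiseContinuousFrom t₀ u) (ht : t₀ ≤ t) :
    ∀ᶠ τ in 𝓝[>] t, ContinuousWithinAt u (Set.Ici t₀) τ := by
  have hclosed := ((hu.1 (t + 1)).subset (Set.sdiff_subset (t := {t}))).isClosed
  filter_upwards [nhdsWithin_le_nhds (hclosed.isOpen_compl.mem_nhds (by simp : t ∈ _)),
    Ioc_mem_nhdsGT (lt_add_one t)] with τ hτ htτ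
  by_contra hdisc
  exact hτ ⟨⟨⟨ht.trans htτ.1.le, htτ.2⟩, hdisc⟩, htτ.1.ne'⟩

theorem IsTargetTrajectory.hasDerivWithinAt_of_tendsto {M : ℕ} {t₀ t : ℝ} {u : ℝ → Space}
    {x : ℝ → Fin M → Space} (hx : IsTargetTrajectory t₀ u x) (hu : PiecewiseContinuousFrom t₀ u)
    (ht : t₀ ≤ t) {w : Space} (hw : Tendsto u (𝓝[>] t) (𝓝 w)) {m : Fin M}
    (hm : (m : ℕ) + 1 = M) : HasDerivWithinAt (fun τ => x τ m) w (Set.Ici t) t := by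
  have hderiv : ∀ᶠ τ in 𝓝[>] t, HasDerivAt (fun τ => x τ m) (u τ) τ := by
    filter_upwards [hu.eventually_continuousWithinAt ht, self_mem_nhdsWithin] with τ hcont htτ
    have ht₀τ : t₀ < τ := ht.trans_lt htτ
    exact (hx.deriv_last τ ht₀τ.le hcont m hm).hasDerivAt (Ici_mem_nhds ht₀τ)
  refine hasDerivWithinAt_Ici_of_tendsto_deriv
    (s := {τ | t < τ ∧ HasDerivAt (fun τ => x τ m) (u τ) τ})
    (fun τ hτ => hτ.2.differentiableAt.differentiableWithinAt)
    ((continuousOn_pi.1 hx.continuousOn m t ht).mono fun τ hτ => ht.trans hτ.1.le)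
    (inter_mem self_mem_nhdsWithin hderiv) (hw.congr' ?_)
  filter_upwards [hderiv] with τ hτ using hτ.deriv.symm

theorem hasDerivWithinAt_piLp {ι : Type*} [Fintype ι] {E : ι → Type*}
    [∀ i, NormedAddCommGroup (E i)] [∀ i, NormedSpace ℝ (E i)] {ξ : ℝ → PiLp 2 E} {ξ' : PiLp 2 E}
    {s : Set ℝ} {t : ℝ} :
    HasDerivWithinAt ξ ξ' s t ↔ ∀ i, HasDerivWithinAt (fun τ => ξ τ i) (ξ' i) s t := by
  simp only [hasDerivWithinAt_iff_hasFDerivWithinAt, hasFDerivWithinAt_piLp (𝕜 := ℝ),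
    ContinuousLinearMap.comp_toSpanSingleton, PiLp.proj_apply]

-- Without this shortcut the search unfolds the two nested `PiLp` layers and times out.
instance {M N : ℕ} : ContinuousSMul ℝ (ErrorSpace M N) := IsBoundedSMul.continuousSMul

variable {M N : ℕ} {A : Matrix (Fin N) (Fin N) ℝ} {α : ℝ} {k : ℕ → ℝ}

/-- The correction of agent `i` in terms of the errors `v` of the position estimates, with agents
at `p` and the target at `q`. -/
noncomputable def errorCorrection (A : Matrix (Fin N) (Fin N) ℝ) (α : ℝ) (p : Fin N → Space)
    (q : Space) (v : Fin N → Space) (i : Fin N) : Space :=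
  act (proj (bearing (p i) q)) (v i) + α • ∑ j, A i j • (v i - v j)

theorem correction_eq_errorCorrection {p : Fin N → Space} {q : Space} {i : Fin N} (h : q ≠ p i)
    (z : Fin N → Space) :
    correction A α p q z i = errorCorrection A α p q (fun j => q - z j) i := by
  have measurement : act (proj (bearing (p i) q)) (p i - z i) =
      act (proj (bearing (p i) q)) (q - z i) := by
    simp only [act_proj_eq_starProjection (norm_bearing h), map_sub, sub_left_inj]
    simpa only [act_proj_eq_starProjection (norm_bearing h)] using act_proj_bearing_eq h
  have consensus : ∑ j, A i j • (q - z i - (q - z j)) = -∑ j, A i j • (z i - z j) := by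
    simp only [sub_sub_sub_cancel_left, ← Finset.sum_neg_distrib, ← smul_neg, neg_sub]
  rw [correction, errorCorrection, measurement, consensus, smul_neg, sub_eq_add_neg]

/-- The right-hand side of the estimation error system, with agents at `p`, the target at `q`,
and the input `w` of the target. -/
noncomputable def errorField [NeZero M] (A : Matrix (Fin N) (Fin N) ℝ) (α : ℝ) (k : ℕ → ℝ)
    (p : Fin N → Space) (q w : Space) (e : ErrorSpace M N) : ErrorSpace M N :=
  WithLp.toLp 2 fun mi =>
    chainField k w (errorCorrection A α p q (fun j => e (0, j)) mi.2) (agentError mi.2 e) mi.1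

theorem errorField_apply [NeZero M] (p : Fin N → Space) (q w : Space) (e : ErrorSpace M N)
    (m : Fin M) (i : Fin N) :
    errorField A α k p q w e (m, i) =
      (if h : (m : ℕ) + 1 < M then e (⟨m + 1, h⟩, i) else w) -
        k (m + 1) • errorCorrection A α p q (fun j => e (0, j)) i :=
  rfl

variable {t₀ s t : ℝ} {u : ℝ → Space} {p : Fin N → ℝ → Space} {x : ℝ → Fin M → Space}
  [NeZero M] {e : ℝ → ErrorSpace M N}

theorem ErrorSolution.continuousOn (he : ErrorSolution A α k p x s e)
    (hx : ContinuousOn x (Set.Ici t₀)) (hs : t₀ ≤ s) : ContinuousOn e (Set.Ici s) := by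
  obtain ⟨z, hz, hez⟩ := he
  have hz' : ContinuousOn z (Set.Ici s) :=
    continuousOn_pi.2 fun i => continuousOn_pi.2 fun m τ hτ => (hz τ hτ i m).continuousWithinAt
  have hx' : ContinuousOn x (Set.Ici s) := hx.mono (Set.Ici_subset_Ici.2 hs)
  have hdiff : ContinuousOn (fun τ (mi : Fin M × Fin N) => x τ mi.1 - z τ mi.2 mi.1) (Set.Ici s) :=
    by fun_prop
  exact ((PiLp.continuous_toLp 2 _).comp_continuousOn hdiff).congr hez

theorem ErrorSolution.hasDerivWithinAt (he : ErrorSolution A α k p x s e)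
    (hx : IsTargetTrajectory t₀ u x) (hu : PiecewiseContinuousFrom t₀ u)
    (hb : IsBearingSensing t₀ p (fun t => x t 0)) (hs : t₀ ≤ s) (ht : s ≤ t) {w : Space}
    (hw : Tendsto u (𝓝[>] t) (𝓝 w)) :
    HasDerivWithinAt e (errorField A α k (fun j => p j t) (x t 0) w (e t)) (Set.Ici t) t := by
  obtain ⟨z, hz, hez⟩ := he
  have ht₀ : t₀ ≤ t := hs.trans ht
  have target (m : Fin M) : HasDerivWithinAt (fun τ => x τ m)
      (if h : (m : ℕ) + 1 < M then x t ⟨m + 1, h⟩ else w) (Set.Ici t) t := by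
    split_ifs with hm
    · exact (hx.deriv_chain t ht₀ m ⟨m + 1, hm⟩ rfl).mono (Set.Ici_subset_Ici.2 ht₀)
    · exact hx.hasDerivWithinAt_of_tendsto hu ht₀ hw (by omega)
  have coord (τ : ℝ) (hτ : s ≤ τ) (m : Fin M) (i : Fin N) : e τ (m, i) = x τ m - z τ i m := by
    rw [hez τ hτ]; rfl
  refine hasDerivWithinAt_piLp.2 fun ⟨m, i⟩ => ?_
  have difference := (target m).sub ((hz t ht i m).mono (Set.Ici_subset_Ici.2 ht))
  rw [correction_eq_errorCorrection (hb.ne t ht₀ i)] at difference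
  refine (difference.congr_deriv ?_).congr (fun τ hτ => coord τ (ht.trans hτ) m i) (coord t ht m i)
  rw [errorField_apply]
  simp only [coord t ht]
  split_ifs
  · abel
  · rw [zero_add]

end ErrorDynamics

section Dissipation

variable {M N : ℕ} [NeZero M] {A : Matrix (Fin N) (Fin N) ℝ} {α γ δ : ℝ} {k : ℕ → ℝ}

theorem norm_lyapunovMap_errorSolution_le (hkM : 0 < k M) {t₀ s T U r : ℝ} {u : ℝ → Space}
    {p : Fin N → ℝ → Space} {x : ℝ → Fin M → Space} {e : ℝ → ErrorSpace M N}
    (he : ErrorSolution A α k p x s e) (hx : IsTargetTrajectory t₀ u x)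
    (hu : PiecewiseContinuousFrom t₀ u) (hb : IsBearingSensing t₀ p (fun t => x t 0))
    (hs : t₀ ≤ s) (hT : s ≤ T) (hU : ∀ τ ∈ Set.Icc s T, ‖u τ‖ ≤ U) (hr : 0 < r)
    (hdiss : ∀ t ∈ Set.Ico s T, ∀ w, 2 * inner ℝ (lyapunovMap k (e t))
        (lyapunovMap k (errorField A α k (fun j => p j t) (x t 0) w (e t))) ≤
      r * (N * (‖(k M)⁻¹ • w‖ / r) ^ 2 - ‖lyapunovMap k (e t)‖ ^ 2)) :
    ‖lyapunovMap k (e T)‖ ≤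
      Real.exp (-(r / 2) * (T - s)) * ‖lyapunovMap k (e s)‖ + √N * ((k M)⁻¹ * U / r) := by
  have hU₀ : 0 ≤ U := (norm_nonneg _).trans (hU s ⟨le_rfl, hT⟩)
  choose! w hw using hu.2.1
  refine norm_le_exp_mul_norm_add_of_inner_deriv_right_le (ξ := fun t => lyapunovMap k (e t))
    (by positivity) hT
    ((lyapunovMap k).continuous.comp_continuousOn
      ((he.continuousOn hx.continuousOn hs).mono Set.Icc_subset_Ici_self))
    (fun t ht => (lyapunovMap k).hasFDerivAt.comp_hasDerivWithinAt t
      (he.hasDerivWithinAt hx hu hb hs ht.1 (hw t (hs.trans ht.1)))) fun t ht => ?_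
  have hwU : ‖w t‖ ≤ U := by
    refine le_of_tendsto (hw t (hs.trans ht.1)).norm ?_
    filter_upwards [Ioc_mem_nhdsGT ht.2] with τ hτ using hU τ ⟨ht.1.trans hτ.1.le, hτ.2⟩
  refine (hdiss t ht (w t)).trans ?_
  rw [norm_smul, Real.norm_of_nonneg (inv_pos.2 hkM).le, mul_pow, Real.sq_sqrt N.cast_nonneg]
  gcongr

variable {G : SimpleGraph (Fin N)}

theorem mul_sum_norm_sq_le_sum_inner_errorCorrection (hG : G.Connected)
    (hA : IsWeightedAdjacency G A) (hα : 0 ≤ α) (hγ : 0 < γ) {μ : ℝ} (hμ : 0 ≤ μ)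
    (hαγ : μ + 1 / γ - 1 ≤ α * minPosEigenvalue (laplacian A)) {t₀ t : ℝ}
    {p : Fin N → ℝ → Space} {q : ℝ → Space} (hb : IsBearingSensing t₀ p q)
    (hexc : SpatialExcitation (μ + γ) t₀ p q) (ht : t₀ ≤ t) (v : Fin N → Space) :
    μ * ∑ i, ‖v i‖ ^ 2 ≤
      ∑ i, inner ℝ (v i) (errorCorrection A α (fun j => p j t) (q t) v i) := by
  have : NeZero N := ⟨(Fin.pos_iff_nonempty.2 hG.nonempty).ne'⟩
  have hγ1 : γ ≤ 1 := (le_add_of_nonneg_left hμ).trans (hexc.le_one hb ht)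
  have unit (i : Fin N) := norm_bearing (hb.ne t ht i)
  exact mul_sum_norm_sq_le_sum_inner_correction hG hA hα hγ hγ1 hαγ
    (fun i => isPositive_toEuclideanLin_proj (unit i))
    (fun i => inner_toEuclideanLin_proj_le (unit i)) (hexc.mul_norm_sq_le ht) v

theorem mul_sum_norm_sq_scaledError_le_sum_inner (hG : G.Connected)
    (hA : IsWeightedAdjacency G A) (hk₁ : 0 < k 1) (hα : 0 ≤ α) (hγ : 0 < γ) {μ : ℝ}
    (hμ : 0 ≤ μ) (hαγ : μ + 1 / γ - 1 ≤ α * minPosEigenvalue (laplacian A)) {t₀ t : ℝ}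
    {p : Fin N → ℝ → Space} {q : ℝ → Space} (hb : IsBearingSensing t₀ p q)
    (hexc : SpatialExcitation (μ + γ) t₀ p q) (ht : t₀ ≤ t) (e : ErrorSpace M N) :
    k 1 * μ * ∑ i, ‖scaledError k 1 (agentError i e)‖ ^ 2 ≤
      ∑ i, inner ℝ (scaledError k 1 (agentError i e))
        (errorCorrection A α (fun j => p j t) (q t) (fun j => e (0, j)) i) := by
  have scaled (i : Fin N) : scaledError k 1 (agentError i e) = (k 1)⁻¹ • e (0, i) :=
    scaledError_succ_apply 0 _
  simp only [scaled, norm_smul, mul_pow, real_inner_smul_left, norm_inv,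
    Real.norm_of_nonneg hk₁.le, ← Finset.mul_sum]
  calc k 1 * μ * ((k 1)⁻¹ ^ 2 * ∑ i, ‖e (0, i)‖ ^ 2)
      = (k 1)⁻¹ * (μ * ∑ i, ‖e (0, i)‖ ^ 2) := by field_simp
    _ ≤ _ := mul_le_mul_of_nonneg_left (mul_sum_norm_sq_le_sum_inner_errorCorrection hG hA hα hγ
        hμ hαγ hb hexc ht fun j => e (0, j)) (inv_pos.2 hk₁).le

theorem exists_two_mul_inner_lyapunovMap_errorField_le (hG : G.Connected)
    (hA : IsWeightedAdjacency G A) (hk : ∀ m, 1 ≤ m → m ≤ M → 0 < k m) (hα : 0 ≤ α)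
    (hδ : 0 < δ) (hγ : 0 < γ)
    (hαγ : muConst M k δ + 1 / γ - 1 ≤ α * minPosEigenvalue (laplacian A))
    (hQ : 3 ≤ M → (qBar M k δ).PosDef) :
    ∃ r > 0, ∀ (t₀ : ℝ) (p : Fin N → ℝ → Space) (q : ℝ → Space), IsBearingSensing t₀ p q →
      SpatialExcitation (muConst M k δ + γ) t₀ p q → ∀ t, t₀ ≤ t → ∀ w (e : ErrorSpace M N),
      2 * inner ℝ (lyapunovMap k e)
          (lyapunovMap k (errorField A α k (fun j => p j t) (q t) w e)) ≤
        r * (N * (‖(k M)⁻¹ • w‖ / r) ^ 2 - ‖lyapunovMap k e‖ ^ 2) := by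
  obtain ⟨r, hr, hdrift⟩ := exists_sum_inner_sub_chainDrift_le (V := Space) hk hδ hQ
  refine ⟨r, hr, fun t₀ p q hb hexc t ht w e => ?_⟩
  set μ := muConst M k δ
  set d := errorCorrection A α (fun j => p j t) (q t) fun j => e (0, j)
  have absorbed : k 1 * μ * ∑ i, ‖scaledError k 1 (agentError i e)‖ ^ 2 ≤
      ∑ i, inner ℝ (scaledError k 1 (agentError i e)) (d i) :=
    mul_sum_norm_sq_scaledError_le_sum_inner hG hA (hk 1 le_rfl NeZero.one_le) hα hγ
      (muConst_pos hk hδ).le hαγ hb hexc ht e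
  calc 2 * inner ℝ (lyapunovMap k e) (lyapunovMap k (errorField A α k (fun j => p j t) (q t) w e))
      = ∑ i, 2 * ∑ m, inner ℝ (scaledIncrement k m (agentError i e))
          (scaledIncrement k m (chainField k w (d i) (agentError i e))) := by
        rw [inner_lyapunovMap, Finset.mul_sum]; rfl
    _ ≤ ∑ i, (2 * (k 1 * μ * ‖scaledError k 1 (agentError i e)‖ ^ 2 -
          inner ℝ (scaledError k 1 (agentError i e)) (d i)) -
          r * ∑ m, ‖scaledIncrement k m (agentError i e)‖ ^ 2 + ‖(k M)⁻¹ • w‖ ^ 2 / r) :=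
        Finset.sum_le_sum fun i _ =>
          sum_inner_scaledIncrement_chainField_le hk hr hdrift w (d i) (agentError i e)
    _ = 2 * (k 1 * μ * ∑ i, ‖scaledError k 1 (agentError i e)‖ ^ 2 -
          ∑ i, inner ℝ (scaledError k 1 (agentError i e)) (d i)) -
          r * ‖lyapunovMap k e‖ ^ 2 + N * (‖(k M)⁻¹ • w‖ ^ 2 / r) := by
        simp only [norm_sq_lyapunovMap, Finset.sum_add_distrib, Finset.sum_sub_distrib,
          ← Finset.mul_sum, Finset.sum_const, Finset.card_univ, Fintype.card_fin, nsmul_eq_mul]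
    _ ≤ N * (‖(k M)⁻¹ • w‖ ^ 2 / r) - r * ‖lyapunovMap k e‖ ^ 2 := by linarith
    _ = r * (N * (‖(k M)⁻¹ • w‖ / r) ^ 2 - ‖lyapunovMap k e‖ ^ 2) := by field_simp

/-- Exponential input-to-state stability with linear gain: solutions decay with overshoot `C` and
rate `r` up to `D` times any bound `U` of the input on the elapsed time interval. -/
def ExpISSEstimate {E F : Type*} [Norm E] [Norm F] (C r D t₀ : ℝ) (u : ℝ → F)
    (Sol : ℝ → (ℝ → E) → Prop) : Prop :=
  ∀ s, t₀ ≤ s → ∀ ξ, Sol s ξ → ∀ t, s ≤ t → ∀ U, (∀ τ ∈ Set.Icc s t, ‖u τ‖ ≤ U) →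
    ‖ξ t‖ ≤ C * Real.exp (-r * (t - s)) * ‖ξ s‖ + D * U

theorem exists_expISSEstimate_errorSolution (hG : G.Connected)
    (hA : IsWeightedAdjacency G A) (hk : ∀ m, 1 ≤ m → m ≤ M → 0 < k m) (hα : 0 ≤ α)
    (hδ : 0 < δ) (hγ : 0 < γ)
    (hαγ : muConst M k δ + 1 / γ - 1 ≤ α * minPosEigenvalue (laplacian A))
    (hQ : 3 ≤ M → (qBar M k δ).PosDef) :
    ∃ C > 0, ∃ r > 0, ∃ D > 0, ∀ (t₀ : ℝ) (u : ℝ → Space) (p : Fin N → ℝ → Space)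
      (x : ℝ → Fin M → Space), PiecewiseContinuousFrom t₀ u → IsTargetTrajectory t₀ u x →
      IsBearingSensing t₀ p (fun t => x t 0) →
      SpatialExcitation (muConst M k δ + γ) t₀ p (fun t => x t 0) →
      ExpISSEstimate C r D t₀ u (ErrorSolution A α k p x) := by
  obtain ⟨r, hr, hdiss⟩ := exists_two_mul_inner_lyapunovMap_errorField_le hG hA hk hα hδ hγ hαγ hQ
  obtain ⟨K, hK, hnorm⟩ := exists_pos_norm_le_mul_norm_lyapunovMap (M := M) (N := N) hk
  set Λ := lyapunovMap (M := M) (N := N) k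
  have hkM : 0 < k M := hk M NeZero.one_le le_rfl
  have hN : (0 : ℝ) < N := Nat.cast_pos.2 (Fin.pos_iff_nonempty.2 hG.nonempty)
  refine ⟨K * (‖Λ‖ + 1), by positivity, r / 2, by positivity, K * (√N * ((k M)⁻¹ / r)),
    by positivity, fun t₀ u p x hu hx hb hexc s hs e he T hT U hU => ?_⟩
  calc ‖e T‖ ≤ K * ‖Λ (e T)‖ := hnorm _
    _ ≤ K * (Real.exp (-(r / 2) * (T - s)) * ‖Λ (e s)‖ + √N * ((k M)⁻¹ * U / r)) := by
        gcongr
        exact norm_lyapunovMap_errorSolution_le hkM he hx hu hb hs hT hU hr fun t ht w =>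
          hdiss t₀ p _ hb hexc t (hs.trans ht.1) w (e t)
    _ ≤ K * (Real.exp (-(r / 2) * (T - s)) * ((‖Λ‖ + 1) * ‖e s‖) + √N * ((k M)⁻¹ * U / r)) := by
        gcongr
        exact (Λ.le_opNorm _).trans (by gcongr; linarith)
    _ = K * (‖Λ‖ + 1) * Real.exp (-(r / 2) * (T - s)) * ‖e s‖ +
          K * (√N * ((k M)⁻¹ / r)) * U := by ring

end Dissipation

section ObserverSolutions

variable {M N : ℕ} {A : Matrix (Fin N) (Fin N) ℝ} {α : ℝ} {k : ℕ → ℝ}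

theorem correction_eq_sub_errorCorrection {p : Fin N → Space} {q : Space} {i : Fin N}
    (h : q ≠ p i) (z : Fin N → Space) :
    correction A α p q z i = act (proj (bearing (p i) q)) q - errorCorrection A α p q z i := by
  have split : act (proj (bearing (p i) q)) (p i - z i) =
      act (proj (bearing (p i) q)) (p i) - act (proj (bearing (p i) q)) (z i) :=
    map_sub (Matrix.toEuclideanLin (proj (bearing (p i) q))) (p i) (z i)
  rw [correction, errorCorrection, ← sub_sub, split, act_proj_bearing_eq h]

theorem errorCorrection_add (p : Fin N → Space) (q : Space) (v w : Fin N → Space) (i : Fin N) :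
    errorCorrection A α p q (fun j => v j + w j) i =
      errorCorrection A α p q v i + errorCorrection A α p q w i := by
  have split : act (proj (bearing (p i) q)) (v i + w i) =
      act (proj (bearing (p i) q)) (v i) + act (proj (bearing (p i) q)) (w i) :=
    map_add (Matrix.toEuclideanLin (proj (bearing (p i) q))) (v i) (w i)
  simp only [errorCorrection, split, add_sub_add_comm, smul_add, Finset.sum_add_distrib]
  abel

theorem errorCorrection_smul (p : Fin N → Space) (q : Space) (c : ℝ) (v : Fin N → Space)
    (i : Fin N) :
    errorCorrection A α p q (fun j => c • v j) i = c • errorCorrection A α p q v i := by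
  have pull : act (proj (bearing (p i) q)) (c • v i) = c • act (proj (bearing (p i) q)) (v i) :=
    map_smul (Matrix.toEuclideanLin (proj (bearing (p i) q))) c (v i)
  simp only [errorCorrection, pull, ← smul_sub, smul_add, Finset.smul_sum, smul_comm c]

theorem continuousOn_errorCorrection {t₀ : ℝ} {p : Fin N → ℝ → Space} {q : ℝ → Space}
    (hb : IsBearingSensing t₀ p q) (v : Fin N → Space) (i : Fin N) :
    ContinuousOn (fun t => errorCorrection A α (fun j => p j t) (q t) v i) (Set.Ici t₀) := by
  have := hb.continuousOn i
  unfold errorCorrection act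
  refine ((PiLp.continuous_toLp 2 _).comp_continuousOn ?_).add continuousOn_const
  fun_prop

variable [NeZero M]

/-- The linear part of the observers of all agents, with agents at `p` and the target at `q`. -/
noncomputable def observerOperator (A : Matrix (Fin N) (Fin N) ℝ) (α : ℝ) (k : ℕ → ℝ)
    (p : Fin N → Space) (q : Space) : (Fin N → Fin M → Space) →ₗ[ℝ] Fin N → Fin M → Space where
  toFun z i := chainField k 0 (errorCorrection A α p q (fun j => z j 0) i) (z i)
  map_add' y z := by
    ext i m : 2
    simp only [chainField, Pi.add_apply, errorCorrection_add, smul_add]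
    split_ifs <;> module
  map_smul' c z := by
    ext i m : 2
    simp only [chainField, Pi.smul_apply, errorCorrection_smul, RingHom.id_apply]
    split_ifs <;> module

theorem exists_isObserverSolution {t₀ s : ℝ} {p : Fin N → ℝ → Space} {q : ℝ → Space}
    (hq : ContinuousOn q (Set.Ici t₀)) (hb : IsBearingSensing t₀ p q) (hs : t₀ ≤ s)
    (z₀ : Fin N → Fin M → Space) : ∃ z, z s = z₀ ∧ IsObserverSolution A α k p q s z := by
  have hsub : Set.Ici s ⊆ Set.Ici t₀ := Set.Ici_subset_Ici.2 hs
  have hlinear : ContinuousOn (fun t => LinearMap.toContinuousLinearMap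
      (observerOperator (M := M) A α k (fun j => p j t) (q t))) (Set.Ici s) := by
    refine continuousOn_clm_apply.2 fun z =>
      continuousOn_pi.2 fun i => continuousOn_pi.2 fun m => ?_
    exact continuousOn_const.sub
      (((continuousOn_errorCorrection hb (fun j => z j 0) i).mono hsub).fun_const_smul _)
  have hforcing : ContinuousOn (fun t i (m : Fin M) =>
      k (m + 1) • act (proj (bearing (p i t) (q t))) (q t)) (Set.Ici s) := by
    refine continuousOn_pi.2 fun i => continuousOn_pi.2 fun m => ?_
    have := (hb.continuousOn i).mono hsub
    have := hq.mono hsub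
    unfold act
    refine ((PiLp.continuous_toLp 2 _).comp_continuousOn ?_).fun_const_smul _
    fun_prop
  obtain ⟨z, hz₀, hz⟩ := exists_isIntegralCurveOn_Ici_of_linear hlinear hforcing z₀
  refine ⟨z, hz₀, fun t ht i m => ?_⟩
  refine (hasDerivWithinAt_pi.1 (hasDerivWithinAt_pi.1 (hz t ht) i) m).congr_deriv ?_
  change chainField k 0 _ (z t i) m + k (m + 1) • act _ _ = _
  rw [correction_eq_sub_errorCorrection (hb.ne t (hsub ht) i), chainField, smul_sub]
  abel

theorem forwardComplete_errorSolution {t₀ : ℝ} {p : Fin N → ℝ → Space} {x : ℝ → Fin M → Space}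
    (hx : ContinuousOn x (Set.Ici t₀)) (hb : IsBearingSensing t₀ p (fun t => x t 0)) :
    ForwardComplete t₀ (ErrorSolution A α k p x) := by
  intro s hs e₀
  obtain ⟨z, hz₀, hz⟩ := exists_isObserverSolution (continuousOn_pi.1 hx 0) hb hs
    fun i m => x s m - e₀ (m, i)
  refine ⟨fun t => estimationError (x t) (z t), ⟨z, hz, fun _ _ => rfl⟩, ?_⟩
  ext1 mi
  simp [estimationError, hz₀]

end ObserverSolutions

section Conclusion

theorem isClassK_mul_left {D : ℝ} (hD : 0 < D) : IsClassK fun a => D * a :=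
  ⟨by fun_prop, fun _ _ _ _ h => mul_lt_mul_of_pos_left h hD, mul_zero D⟩

theorem isClassKL_exp {C r : ℝ} (hC : 0 < C) (hr : 0 < r) :
    IsClassKL fun a t => C * Real.exp (-r * t) * a where
  continuousOn := by fun_prop
  classK t _ := isClassK_mul_left (by positivity)
  antitoneOn a ha t _ t' _ h := by
    have hrt : -r * t' ≤ -r * t := mul_le_mul_of_nonpos_left h (neg_nonpos.2 hr.le)
    dsimp only
    gcongr
  tendsto_zero a _ := by
    have hexp := Real.tendsto_exp_atBot.comp
      (Filter.tendsto_id.const_mul_atTop_of_neg (neg_lt_zero.2 hr))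
    simpa using (hexp.const_mul C).mul_const a

theorem piecewiseContinuousFrom_const {E : Type*} [TopologicalSpace E] (t₀ : ℝ) (w : E) :
    PiecewiseContinuousFrom t₀ fun _ => w :=
  ⟨fun T => by simp [continuousWithinAt_const], fun _ _ => ⟨w, tendsto_const_nhds⟩,
    fun _ _ => ⟨w, tendsto_const_nhds⟩⟩

theorem ExpISSEstimate.ugesWith {E F : Type*} [Norm E] [NormedAddGroup F] {C r D t₀ : ℝ}
    {Sol : ℝ → (ℝ → E) → Prop} (h : ExpISSEstimate C r D t₀ (fun _ => (0 : F)) Sol)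
    (hSol : ForwardComplete t₀ Sol) : UGESWith C r t₀ Sol :=
  ⟨hSol, fun s hs ξ hξ t ht => by
    simpa using h s hs ξ hξ t ht 0 fun _ _ => norm_zero.le⟩

theorem ExpISSEstimate.issWith {E F : Type*} [Norm E] [Norm F] {C r D t₀ : ℝ} {u : ℝ → F}
    {Sol : ℝ → (ℝ → E) → Prop} (h : ExpISSEstimate C r D t₀ u Sol)
    (hSol : ForwardComplete t₀ Sol) (hu : BoundedFrom t₀ u) :
    ISSWith (fun a t => C * Real.exp (-r * t) * a) (fun a => D * a) t₀ u Sol := by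
  obtain ⟨B, hB⟩ := hu
  refine ⟨hSol, fun s hs ξ hξ t ht => h s hs ξ hξ t ht _ fun τ hτ => ?_⟩
  refine le_csSup ⟨B, ?_⟩ (Set.mem_image_of_mem _ hτ)
  rintro _ ⟨σ, hσ, rfl⟩
  exact hB σ (hs.trans hσ.1)

end Conclusion

end BearingObserver

open BearingObserver in
theorem mainTheorem5 {M N : ℕ} [NeZero M] (hN : 2 ≤ N)
    (G : SimpleGraph (Fin N)) (hG : G.Connected)
    (A : Matrix (Fin N) (Fin N) ℝ) (hA : IsWeightedAdjacency G A)
    (k : ℕ → ℝ) (hk : ∀ m, 1 ≤ m → m ≤ M → 0 < k m)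
    (α δ γ : ℝ) (hα : 0 < α) (hδ : 0 < δ) (hγ : 0 < γ)
    (hαγ : α > (muConst M k δ + 1 / γ - 1) / minPosEigenvalue (laplacian A))
    (hQ : 3 ≤ M → (qBar M k δ).PosDef) :
    -- the two expressions of the measurement agree
    (∀ p q : Space, q ≠ p → act (proj (bearing p q)) p = act (proj (bearing p q)) q) ∧
    -- UGES of the estimation error for the autonomous target
    (∃ C r : ℝ, 0 < C ∧ 0 < r ∧
      ∀ (t₀ : ℝ) (p : Fin N → ℝ → Space) (x : ℝ → Fin M → Space),
        IsTargetTrajectory t₀ (fun _ => 0) x →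
        IsBearingSensing t₀ p (fun t => x t 0) →
        SpatialExcitation (muConst M k δ + γ) t₀ p (fun t => x t 0) →
        UGESWith C r t₀ (ErrorSolution A α k p x)) ∧
    -- ISS of the estimation error with respect to the input of the target
    (∃ (β : ℝ → ℝ → ℝ) (ρ : ℝ → ℝ), IsClassKL β ∧ IsClassK ρ ∧
      ∀ (t₀ : ℝ) (u : ℝ → Space) (p : Fin N → ℝ → Space) (x : ℝ → Fin M → Space),
        BoundedFrom t₀ u → PiecewiseContinuousFrom t₀ u →
        IsTargetTrajectory t₀ u x →
        IsBearingSensing t₀ p (fun t => x t 0) →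
        SpatialExcitation (muConst M k δ + γ) t₀ p (fun t => x t 0) →
        ISSWith β ρ t₀ u (ErrorSolution A α k p x)) := by
  have hαγ' := (div_lt_iff₀ (hA.minPosEigenvalue_pos hG hN)).1 hαγ
  obtain ⟨C, hC, r, hr, D, hD, hest⟩ :=
    exists_expISSEstimate_errorSolution hG hA hk hα.le hδ hγ hαγ'.le hQ
  refine ⟨fun p q => act_proj_bearing_eq, ⟨C, r, hC, hr, fun t₀ p x hx hb hexc => ?_⟩,
    ⟨_, _, isClassKL_exp hC hr, isClassK_mul_left hD, fun t₀ u p x hbdd hu hx hb hexc => ?_⟩⟩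
  · exact (hest t₀ _ p x (piecewiseContinuousFrom_const t₀ 0) hx hb hexc).ugesWith
      (forwardComplete_errorSolution hx.continuousOn hb)
  · exact (hest t₀ u p x hu hx hb hexc).issWith
      (forwardComplete_errorSolution hx.continuousOn hb) hbdd
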